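/- Let $X$ be a real separable Hilbert space, $T>0$, and let $\{U(t,s)\}_{0\le s\le t\le T}$, $\{B(t)\}_{0\le t\le T}$ be families in $\mathcal L(X)$ and $f:[0,T]\to X$ a function. For $0\le s\le t\le T$ and $x\in X$ put $$Q(t,s)=\int_s^t U(t,r)B(r)B^*(r)U^*(t,r)\,dr\ \text{ (strong integral)},\qquad m^x(t,s)=U(t,s)x+\int_s^tU(t,r)f(r)\,dr .$$ Assume: (H1) (i) $(s,t)\mapsto U(t,s)x$ is continuous on $\{0\le s\le t\le T\}$ for every $x\in X$, $U(t,t)=I$, and $U(t,s)U(s,r)=U(t,r)$ for $0\le r\le s\le t\le T$; (ii) $\sup_{t}\|B(t)\|<\infty$ and $t\mapsto B(t)x$ is measurable for every $x\in X$; (iii) $f$ is bounded and measurable; (iv) for all $0\le s\le t\le T$, $Q(t,s)$ is non-negative, symmetric and of finite trace. (H2) $U(t,s)(X)\subseteq Q(t,s)^{1/2}(X)$ for all $0\le s<t\le T$. For $s<t$ let $\Lambda(t,s)=Q(t,s)^{-1/2}U(t,s)\in\mathcal L(X)$, where $Q(t,s)^{-1/2}$ is the pseudo-inverse of $Q(t,s)^{1/2}$.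 Let $\mathcal N_{m,Q}$ be the Gaussian measure on $X$ with mean $m$ and covariance operator $Q$, and for bounded Borel $\varphi:X\to\mathbb R$ let $P_{s,t}\varphi(x)=\int_X\varphi\,d\mathcal N_{m^x(t,s),Q(t,s)}$. For $a$ in the closure of $Q^{1/2}(X)$, $y\mapsto\langle a,Q^{-1/2}y\rangle$ denotes the Gaussian random variable in $L^2(X,\mathcal N_{0,Q})$ obtained by extending by continuity the isometry $Q^{1/2}b\mapsto\langle b,\cdot\rangle$. Let $C^k_b(X)$ be the space of the $k$ times continuously Fréchet differentiable functions $X\to\mathbb R$ that are bounded together with their derivatives up to order $k$. Then for all $0\le s<t\le T$ and all bounded Borel $\varphi:X\to\mathbb R$: (a) $P_{s,t}\varphi\in\bigcap_{k\in\mathbb N}C^k_b(X)$. (b) For all $x,h\in X$, $$\langle\nabla P_{s,t}\varphi(x),h\rangle=\int_X\varphi(y+m^x(t,s))\,\langle\Lambda(t,s)h,Q(t,s)^{-1/2}y\rangle\,\mathcal N_{0,Q(t,s)}(dy).$$ (c) For all $n\ge2$ and $x,h_1,\dots,h_n\in X$, $$D^nP_{s,t}\varphi(x)(h_1,\dots,h_n)=\int_X\varphi(m^x(t,s)+y)\,I_n(t,s)(y)(h_1,\dots,h_n)\,\mathcal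 N_{0,Q(t,s)}(dy),$$ where, with $\Lambda=\Lambda(t,s)$ and $Q=Q(t,s)$, $$I_n(t,s)(y)(h_1,\dots,h_n)=\prod_{i=1}^n\langle\Lambda h_i,Q^{-1/2}y\rangle+\sum_{r=1}^{\lfloor n/2\rfloor}(-1)^r\sum_{(i_1,\dots,i_{2r})}\ \prod_{k=1}^r\langle\Lambda h_{i_{2k-1}},\Lambda h_{i_{2k}}\rangle\prod_{m\notin\{i_1,\dots,i_{2r}\}}\langle\Lambda h_m,Q^{-1/2}y\rangle,$$ the inner sum running over all pairwise distinct $i_1,\dots,i_{2r}\in\{1,\dots,n\}$ with $i_{2k-1}<i_{2k}$ for $1\le k\le r$ and $i_{2k-1}<i_{2k+1}$ for $1\le k<r$. The integrands in (b) and (c) are integrable. (d) For every $n\ge1$, $$\sup_{x\in X}\|D^nP_{s,t}\varphi(x)\|_{\mathcal L^n(X)}\le C_n\,\|\varphi\|_\infty\,\|\Lambda(t,s)\|_{\mathcal L(X)}^n,$$ where $C_n>0$ depends only on $n$. -/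

import Mathlib

open MeasureTheory ProbabilityTheory Filter Topology

namespace NonautonomousOU

noncomputable section

variable {X : Type*} [NormedAddCommGroup X] [InnerProductSpace ℝ X] [CompleteSpace X]

/-- The strong operator integral `x ↦ ∫_s^t G(r) x dr` of a family of bounded operators, as a
bounded operator (and `0` if the pointwise integrals do not form a bounded linear operator). -/
def strongIntegral (G : ℝ → X →L[ℝ] X) (s t : ℝ) : X →L[ℝ] X :=
  open Classical in
  if h : ∃ L : X →L[ℝ] X, ∀ x, L x = ∫ r in s..t, G r x then h.choose else 0

/-- The integrand `U(t,r) B(r) B(r)* U(t,r)*` of the covariance operator. -/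
def covDensity (U : ℝ → ℝ → X →L[ℝ] X) (B : ℝ → X →L[ℝ] X) (t r : ℝ) : X →L[ℝ] X :=
  (U t r).comp ((B r).comp
    ((ContinuousLinearMap.adjoint (B r)).comp (ContinuousLinearMap.adjoint (U t r))))

/-- `Q(t,s) = ∫_s^t U(t,r) B(r) B(r)* U(t,r)* dr`, a strong integral. -/
def covOp (U : ℝ → ℝ → X →L[ℝ] X) (B : ℝ → X →L[ℝ] X) (t s : ℝ) : X →L[ℝ] X :=
  strongIntegral (covDensity U B t) s t

/-- `m^x(t,s) = U(t,s) x + ∫_s^t U(t,r) f(r) dr`. -/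
def meanVec (U : ℝ → ℝ → X →L[ℝ] X) (f : ℝ → X) (t s : ℝ) (x : X) : X :=
  U t s x + ∫ r in s..t, U t r (f r)

/-- Non-negative symmetric operators with finite trace (for non-negative operators the trace does
not depend on the orthonormal basis). -/
def IsPosTraceClass (Q : X →L[ℝ] X) : Prop :=
  Q.IsPositive ∧ ∃ (w : Set X) (b : HilbertBasis w ℝ X),
    Summable fun i => inner ℝ (Q (b i)) (b i)

/-- Assumptions on the evolution operator `U(t,s)`, `0 ≤ s ≤ t ≤ T`, the operators `B(t)` and the
function `f`. -/
structure EvolutionHyp (T : ℝ) (U : ℝ → ℝ → X →L[ℝ] X) (B : ℝ → X →L[ℝ] X) (f : ℝ → X) :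
    Prop where
  strongCont : ∀ x : X, ContinuousOn (fun p : ℝ × ℝ => U p.2 p.1 x)
    {p | 0 ≤ p.1 ∧ p.1 ≤ p.2 ∧ p.2 ≤ T}
  diag : ∀ t, 0 ≤ t → t ≤ T → U t t = ContinuousLinearMap.id ℝ X
  comp : ∀ r s t, 0 ≤ r → r ≤ s → s ≤ t → t ≤ T → (U t s).comp (U s r) = U t r
  B_bdd : ∃ M : ℝ, ∀ t ∈ Set.Icc 0 T, ‖B t‖ ≤ M
  B_meas : ∀ x : X, AEStronglyMeasurable (fun t => B t x) (volume.restrict (Set.Icc 0 T))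
  f_bdd : ∃ M : ℝ, ∀ t ∈ Set.Icc 0 T, ‖f t‖ ≤ M
  f_meas : AEStronglyMeasurable f (volume.restrict (Set.Icc 0 T))
  traceClass : ∀ s t, 0 ≤ s → s ≤ t → t ≤ T → IsPosTraceClass (covOp U B t s)

/-- The non-negative symmetric square root `Q^{1/2}` of a non-negative symmetric operator. -/
def sqrtOp (Q : X →L[ℝ] X) : X →L[ℝ] X :=
  open Classical in
  if h : ∃ S : X →L[ℝ] X, S.IsPositive ∧ S.comp S = Q then h.choose else 0

/-- The pseudo-inverse of `S`: for `y` in the range of `S`, the unique `x ∈ (ker S)ᗮ` such that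
`S x = y`. -/
def pseudoInv (S : X →L[ℝ] X) (y : X) : X :=
  open Classical in
  if h : ∃ x : X, x ∈ (LinearMap.ker (S : X →ₗ[ℝ] X))ᗮ ∧ S x = y then h.choose else 0

/-- `U(t,s)(X) ⊆ Q(t,s)^{1/2}(X)` for `0 ≤ s < t ≤ T`. -/
def RangeHyp (T : ℝ) (U : ℝ → ℝ → X →L[ℝ] X) (B : ℝ → X →L[ℝ] X) : Prop :=
  ∀ s t, 0 ≤ s → s < t → t ≤ T → Set.range (U t s) ⊆ Set.range (sqrtOp (covOp U B t s))

/-- The bounded operator `x ↦ S⁻¹ (V x)`, with `S⁻¹` the pseudo-inverse; it exists as soon as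
the range of `V` is contained in the range of `S`, see `pseudoInvComp_apply`. -/
def pseudoInvComp (S V : X →L[ℝ] X) : X →L[ℝ] X :=
  open Classical in
  if h : ∃ L : X →L[ℝ] X, ∀ x, L x = pseudoInv S (V x) then h.choose else 0

/-- `Λ(t,s) = Q(t,s)^{-1/2} U(t,s)`. -/
def Lam (U : ℝ → ℝ → X →L[ℝ] X) (B : ℝ → X →L[ℝ] X) (t s : ℝ) : X →L[ℝ] X :=
  pseudoInvComp (sqrtOp (covOp U B t s)) (U t s)

/-- Multilinear form `I_n(h_1, …, h_n)` in the numbers `w i = ⟨Λ h_i, Q^{-1/2} y⟩` and the vectors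
`a i = Λ h_i`. The inner sum is over the sets of `r` disjoint pairs `{i (k,0), i (k,1)}` of indices,
each listed once: in every pair the smaller index comes first, and the pairs are ordered by their
first indices. -/
def hermiteForm {n : ℕ} (a : Fin n → X) (w : Fin n → ℝ) : ℝ :=
  open Classical in
  ∏ i, w i + ∑ r ∈ Finset.Icc 1 (n / 2), (-1 : ℝ) ^ r *
    ∑ i : Fin r × Fin 2 → Fin n with
        Function.Injective i ∧ (∀ k, i (k, 0) < i (k, 1)) ∧ StrictMono (fun k => i (k, 0)),
      (∏ k, inner ℝ (a (i (k, 0))) (a (i (k, 1)))) * ∏ m with m ∉ Set.range i, w m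

/-- `f ∈ C^k_b(X)`: all derivatives up to the order `k` exist, are continuous and bounded. -/
def IsCkb (k : ℕ) (f : X → ℝ) : Prop :=
  ContDiff ℝ k f ∧ ∀ j ≤ k, ∃ M : ℝ, ∀ x, ‖iteratedFDeriv ℝ j f x‖ ≤ M

/-- The pseudo-inverse composition is the expected operator (closed graph theorem). -/
theorem pseudoInvComp_apply (S V : X →L[ℝ] X) (h : Set.range V ⊆ Set.range S) (x : X) :
    pseudoInvComp S V x = pseudoInv S (V x) := by
  have hK : IsClosed ((LinearMap.ker (S : X →ₗ[ℝ] X) : Submodule ℝ X) : Set X) :=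
    S.isClosed_ker
  have : CompleteSpace (LinearMap.ker (S : X →ₗ[ℝ] X)) := hK.completeSpace_coe
  have key : ∀ x, pseudoInv S (V x) ∈ (LinearMap.ker (S : X →ₗ[ℝ] X))ᗮ ∧
      S (pseudoInv S (V x)) = V x := by
    intro x
    have hex : ∃ z : X, z ∈ (LinearMap.ker (S : X →ₗ[ℝ] X))ᗮ ∧ S z = V x := by
      obtain ⟨z, hz⟩ := h ⟨x, rfl⟩
      obtain ⟨p, hp, q, hq, rfl⟩ :=
        (LinearMap.ker (S : X →ₗ[ℝ] X)).exists_add_mem_mem_orthogonal z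
      refine ⟨q, hq, ?_⟩
      have : S p = 0 := hp
      rw [← hz, map_add, this, zero_add]
    simpa only [pseudoInv, dif_pos hex] using hex.choose_spec
  have uniq : ∀ a b : X, a ∈ (LinearMap.ker (S : X →ₗ[ℝ] X))ᗮ →
      b ∈ (LinearMap.ker (S : X →ₗ[ℝ] X))ᗮ → S a = S b → a = b := by
    intro a b ha hb hab
    have h1 : a - b ∈ LinearMap.ker (S : X →ₗ[ℝ] X) := by
      simp [hab]
    have h2 := Submodule.sub_mem _ ha hb
    have h3 := (Submodule.mem_orthogonal _ _).1 h2 _ h1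
    exact sub_eq_zero.1 (inner_self_eq_zero.1 h3)
  let g : X →ₗ[ℝ] X :=
    { toFun := fun x => pseudoInv S (V x)
      map_add' := fun a b => uniq _ _ (key _).1 (Submodule.add_mem _ (key _).1 (key _).1) (by
        rw [(key _).2, map_add, map_add, (key _).2, (key _).2])
      map_smul' := fun c a => uniq _ _ (key _).1 (Submodule.smul_mem _ _ (key _).1) (by
        rw [(key _).2, map_smul, map_smul, (key _).2]; rfl) }
  have hg : Continuous g := by
    refine g.continuous_of_seq_closed_graph fun u a b hu hgu => ?_
    refine (uniq _ _ (key a).1 ?_ ?_).symm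
    · exact (Submodule.isClosed_orthogonal _).mem_of_tendsto hgu
        (Eventually.of_forall fun n => (key _).1)
    · rw [(key a).2]
      refine tendsto_nhds_unique ((V.continuous.tendsto a).comp hu) ?_
      refine ((S.continuous.tendsto b).comp hgu).congr fun n => ?_
      exact (key _).2
  have hex : ∃ L : X →L[ℝ] X, ∀ x, L x = pseudoInv S (V x) := ⟨⟨g, hg⟩, fun _ => rfl⟩
  simpa only [pseudoInvComp, dif_pos hex] using hex.choose_spec x

/-- The strong integral is the expected operator. -/
theorem strongIntegral_apply (G : ℝ → X →L[ℝ] X) {s t : ℝ} (hst : s ≤ t) (M : ℝ)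
    (hM : ∀ r ∈ Set.Icc s t, ‖G r‖ ≤ M)
    (hm : ∀ x, AEStronglyMeasurable (fun r => G r x) (volume.restrict (Set.Icc s t))) (x : X) :
    strongIntegral G s t x = ∫ r in s..t, G r x := by
  have hb : ∀ x, ∀ r ∈ Set.Icc s t, ‖G r x‖ ≤ M * ‖x‖ := fun x r hr =>
    (G r).le_of_opNorm_le (hM r hr) x
  have hi : ∀ x, IntervalIntegrable (fun r => G r x) volume s t := fun x => by
    rw [intervalIntegrable_iff_integrableOn_Icc_of_le hst]
    refine Integrable.of_bound (hm x) (M * ‖x‖) ?_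
    exact (ae_restrict_iff' measurableSet_Icc).2 (Eventually.of_forall (hb x))
  let g : X →ₗ[ℝ] X :=
    { toFun := fun x => ∫ r in s..t, G r x
      map_add' := fun a b => by
        simp only [map_add]; exact intervalIntegral.integral_add (hi a) (hi b)
      map_smul' := fun c a => by
        simp only [map_smul, RingHom.id_apply]; exact intervalIntegral.integral_smul c _ }
  have hex : ∃ L : X →L[ℝ] X, ∀ x, L x = ∫ r in s..t, G r x :=
    ⟨g.mkContinuous (M * |t - s|) fun x => by
      have := intervalIntegral.norm_integral_le_of_norm_le_const (a := s) (b := t)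
        (C := M * ‖x‖) (f := fun r => G r x) (fun r hr => by
          rw [Set.uIoc_of_le hst] at hr
          exact hb x r ⟨hr.1.le, hr.2⟩)
      calc ‖g x‖ ≤ M * ‖x‖ * |t - s| := this
        _ = _ := by ring, fun _ => rfl⟩
  simpa only [strongIntegral, dif_pos hex] using hex.choose_spec x

/-- Weak measurability implies strong measurability on a separable space. -/
theorem aesm_of_inner [TopologicalSpace.SeparableSpace X] {μ : Measure ℝ} {v : ℝ → X}
    (h : ∀ x, AEStronglyMeasurable (fun r => inner ℝ x (v r)) μ) : AEStronglyMeasurable v μ := by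
  obtain ⟨w, b, -⟩ := exists_hilbertBasis ℝ X
  have hc : Countable w := by
    have hd : Pairwise fun i j : w =>
        Disjoint (Metric.ball (b i) (1 / 2)) (Metric.ball (b j) (1 / 2)) := by
      intro i j hij
      refine Metric.ball_disjoint_ball ?_
      have h1 : ‖b i - b j‖ ^ 2 = 2 := by
        rw [norm_sub_sq_real, b.orthonormal.1, b.orthonormal.1, b.orthonormal.2 hij]; norm_num
      rw [dist_eq_norm]
      nlinarith [norm_nonneg (b i - b j)]
    exact hd.countable_of_isOpen_disjoint (fun i => Metric.isOpen_ball)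
      fun i => ⟨b i, Metric.mem_ball_self (by norm_num)⟩
  refine aestronglyMeasurable_of_tendsto_ae (u := (atTop : Filter (Finset w)))
    (f := fun F r => ∑ i ∈ F, inner ℝ (b i) (v r) • b i) (fun F => ?_)
    (Eventually.of_forall fun r => ?_)
  · refine Finset.aestronglyMeasurable_fun_sum _ fun i _ => ?_
    exact (h (b i)).smul_const _
  · have := b.hasSum_repr (v r)
    simp only [b.repr_apply_apply] at this
    exact this

/-- On `[0,T]`, `covOp` is given by the pointwise integrals. -/
theorem covOp_apply [TopologicalSpace.SeparableSpace X] {T : ℝ} {U : ℝ → ℝ → X →L[ℝ] X}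
    {B : ℝ → X →L[ℝ] X} {f : ℝ → X} (H : EvolutionHyp T U B f) {s t : ℝ} (hs : 0 ≤ s)
    (hst : s ≤ t) (ht : t ≤ T) (x : X) :
    covOp U B t s x = ∫ r in s..t, covDensity U B t r x := by
  have hcont : ∀ x, ContinuousOn (fun r => U t r x) (Set.Icc s t) := fun x =>
    (H.strongCont x).comp (f := fun r : ℝ => (r, t)) (by fun_prop)
      fun r hr => ⟨hs.trans hr.1, hr.2, ht⟩
  have hsub : Set.Icc s t ⊆ Set.Icc 0 T := Set.Icc_subset_Icc hs ht
  have hUb : ∃ K, ∀ r : Set.Icc s t, ‖U t r‖ ≤ K := by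
    refine banach_steinhaus fun x => ?_
    obtain ⟨K, hK⟩ := isCompact_Icc.exists_bound_of_continuousOn (hcont x)
    exact ⟨K, fun r => hK r r.2⟩
  obtain ⟨K, hK⟩ := hUb
  obtain ⟨M, hM⟩ := H.B_bdd
  have hUm : ∀ x, AEStronglyMeasurable (fun r => U t r x) (volume.restrict (Set.Icc s t)) :=
    fun x => (hcont x).aestronglyMeasurable measurableSet_Icc
  have hBm : ∀ x, AEStronglyMeasurable (fun r => B r x) (volume.restrict (Set.Icc s t)) :=
    fun x => (H.B_meas x).mono_measure (Measure.restrict_mono hsub le_rfl)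
  have hadj : ∀ (A : ℝ → X →L[ℝ] X) (v : ℝ → X),
      (∀ x, AEStronglyMeasurable (fun r => A r x) (volume.restrict (Set.Icc s t))) →
      AEStronglyMeasurable v (volume.restrict (Set.Icc s t)) →
      AEStronglyMeasurable (fun r => ContinuousLinearMap.adjoint (A r) (v r))
        (volume.restrict (Set.Icc s t)) := by
    intro A v hA hv
    refine aesm_of_inner fun x => ?_
    simp only [ContinuousLinearMap.adjoint_inner_right]
    exact (hA x).inner hv
  have happ : ∀ (A : ℝ → X →L[ℝ] X) (v : ℝ → X),
      (∀ x, AEStronglyMeasurable (fun r => A r x) (volume.restrict (Set.Icc s t))) →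
      AEStronglyMeasurable v (volume.restrict (Set.Icc s t)) →
      AEStronglyMeasurable (fun r => A r (v r)) (volume.restrict (Set.Icc s t)) := by
    intro A v hA hv
    have := hadj (fun r => ContinuousLinearMap.adjoint (A r)) v
      (fun x => hadj A _ hA aestronglyMeasurable_const) hv
    simpa only [ContinuousLinearMap.adjoint_adjoint] using this
  refine strongIntegral_apply (covDensity U B t) hst (K * (M * (M * K))) (fun r hr => ?_)
    (fun x => ?_) x
  · have h1 := hK ⟨r, hr⟩
    have h2 := hM r (hsub hr)
    have hK0 : 0 ≤ K := (norm_nonneg _).trans h1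
    have hM0 : 0 ≤ M := (norm_nonneg _).trans h2
    have h3 : ‖ContinuousLinearMap.adjoint (U t r)‖ ≤ K := by simpa using h1
    have h4 : ‖ContinuousLinearMap.adjoint (B r)‖ ≤ M := by simpa using h2
    refine (ContinuousLinearMap.opNorm_comp_le _ _).trans (mul_le_mul h1 ?_ (norm_nonneg _) hK0)
    refine (ContinuousLinearMap.opNorm_comp_le _ _).trans (mul_le_mul h2 ?_ (norm_nonneg _) hM0)
    exact (ContinuousLinearMap.opNorm_comp_le _ _).trans (mul_le_mul h4 h3 (norm_nonneg _) hM0)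
  · exact happ (U t) _ hUm (happ B _ hBm (hadj B _ hBm
      (hadj (U t) _ hUm aestronglyMeasurable_const)))

variable [MeasurableSpace X] [BorelSpace X]

/-- `μ` is the Gaussian measure with mean `m` and covariance operator `Q`. -/
def IsGaussianWith (m : X) (Q : X →L[ℝ] X) (μ : Measure X) : Prop :=
  IsGaussian μ ∧ ∫ y, y ∂μ = m ∧ ∀ a b, covarianceBilin μ a b = inner ℝ (Q a) b

/-- The Gaussian measure `N_{m,Q}`; it exists for every non-negative symmetric `Q` with finite
trace on a separable space, and is determined by its mean and covariance. -/
def gaussian (m : X) (Q : X →L[ℝ] X) : Measure X :=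
  open Classical in
  if h : ∃ μ : Measure X, IsGaussianWith m Q μ then h.choose else 0

/-- `P_{s,t} φ (x) = ∫ φ dN_{m^x(t,s), Q(t,s)}`. -/
def transOp (U : ℝ → ℝ → X →L[ℝ] X) (B : ℝ → X →L[ℝ] X) (f : ℝ → X) (s t : ℝ) (φ : X → ℝ)
    (x : X) : ℝ :=
  ∫ y, φ y ∂(gaussian (meanVec U f t s x) (covOp U B t s))

/-- `w` is a version of the Gaussian random variable `y ↦ ⟨a, Q^{-1/2} y⟩` on `(X, N_{0,Q})`: for
`a = Q^{1/2} b` this is `y ↦ ⟨b, y⟩`, and the isometry `Q^{1/2} b ↦ ⟨b, ·⟩ ∈ L²(N_{0,Q})` is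
extended by continuity to all `a` in the closure of the range of `Q^{1/2}`. -/
def IsWhiteNoise (Q : X →L[ℝ] X) (a : X) (w : X → ℝ) : Prop :=
  MemLp w 2 (gaussian 0 Q) ∧ ∃ b : ℕ → X,
    Tendsto (fun k => sqrtOp Q (b k)) atTop (𝓝 a) ∧
    Tendsto (fun k => eLpNorm (fun y => inner ℝ (b k) y - w y) 2 (gaussian 0 Q)) atTop (𝓝 0)

/-- The random variable `y ↦ ⟨a, Q^{-1/2} y⟩` on `(X, N_{0,Q})`. -/
def whiteNoise (Q : X →L[ℝ] X) (a : X) : X → ℝ :=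
  open Classical in
  if h : ∃ w : X → ℝ, IsWhiteNoise Q a w then h.choose else 0

/-- `I_n(t,s)(y)(h_1, …, h_n)`. -/
def In (U : ℝ → ℝ → X →L[ℝ] X) (B : ℝ → X →L[ℝ] X) (t s : ℝ) {n : ℕ} (y : X) (h : Fin n → X) :
    ℝ :=
  hermiteForm (fun i => Lam U B t s (h i))
    (fun i => whiteNoise (covOp U B t s) (Lam U B t s (h i)) y)

end

end NonautonomousOU

/-! Write `Q`, `Λ`, `m` for the covariance, `Q^{-1/2}U` and the mean at fixed `s < t`, and `W h` for
the Gaussian variable `⟨Λ h, Q^{-1/2} y⟩`. Since `U v = Q^{1/2} Λ v`, moving the starting point from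
`x` to `x + v` translates the Gaussian measure by a Cameron–Martin vector. The Cameron–Martin
formula (`IsWhiteNoise.map_add_eq_tilted`) therefore moves the dependence on `v` from `φ`, which is
merely measurable, to a smooth density: the transition operator at `x + v` is the integral of `φ(y +
m^x)` against `exp(W v - ‖Λ v‖²/2)` (`transOp_add_eq_wickTransform`).

Smoothness: expanding `exp(W v)` gives a power series in `v` whose coefficients are moments of
products of the variables `W h`. Gaussian moment bounds with a free parameter make its radius
infinite, so the function is analytic (`contDiff_wickTransform`).

Formulas: differentiating the density `n` times multiplies it by a Hermite polynomial in the
variables `W h_i - ⟨Λ v, Λ h_i⟩`. The combinatorial core is that the sum over pairings defining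
`hermiteForm` satisfies the Hermite recurrence (`hasDerivAt_hermiteForm`), proved by distinguishing
whether the new index is paired. At `v = 0` the density is almost surely `1` and the form becomes
`I_n`. Translating every point `x` to `v = 0` gives the formulas everywhere, with bounds uniform in
`x`.

Norm bounds: `|hermiteForm|` is at most a combinatorial constant times `∏ (‖Λ h_i‖ + |W h_i|)`,
whose expectation is at most a constant times `∏ ‖Λ h_i‖`.

The objects selected by choice (square root, Gaussian measure, white noise) must first be shown to
exist. This is done by the binomial series, a Karhunen–Loève type series and completeness of `L²`
respectively. -/

namespace NonautonomousOU

/-! ### Square roots of non-negative operators by the binomial series. -/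

section SquareRoot

/-- The Taylor coefficients of `1 - √(1 - x)`: the coefficient of `x ^ (n + 1)`. -/
noncomputable def sqrtCoeff (n : ℕ) : ℝ := catalan n / (2 * 4 ^ n)

theorem sqrtCoeff_nonneg (n : ℕ) : 0 ≤ sqrtCoeff n := by unfold sqrtCoeff; positivity

theorem sqrtCoeff_zero : sqrtCoeff 0 = 1 / 2 := by simp [sqrtCoeff]

/-- Catalan convolution. It is the coefficient form of `R² = 2R - x` for `R = 1 - √(1 - x)`. -/
theorem sum_antidiagonal_sqrtCoeff (n : ℕ) :
    ∑ p ∈ Finset.HasAntidiagonal.antidiagonal n, sqrtCoeff p.1 * sqrtCoeff p.2 =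
      2 * sqrtCoeff (n + 1) := by
  have h : ∀ p ∈ Finset.HasAntidiagonal.antidiagonal n, sqrtCoeff p.1 * sqrtCoeff p.2
      = (catalan p.1 * catalan p.2 : ℝ) / (4 * 4 ^ n) := by
    intro p hp
    rw [← Finset.HasAntidiagonal.mem_antidiagonal.1 hp, pow_add, sqrtCoeff, sqrtCoeff]
    field_simp
    ring
  rw [Finset.sum_congr rfl h, ← Finset.sum_div, sqrtCoeff, catalan_succ']
  push_cast
  field_simp
  ring

/-- The closed form telescopes; it yields both the summability and the bound `1` on the total mass,
the latter being what makes `1 - R` non-negative. -/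
theorem sum_range_sqrtCoeff (N : ℕ) :
    ∑ n ∈ Finset.range N, sqrtCoeff n = 1 - N.centralBinom / 4 ^ N := by
  induction N with
  | zero => simp
  | succ N ih =>
    rw [Finset.sum_range_succ, ih, sqrtCoeff]
    have h1 : ((N : ℝ) + 1) * catalan N = N.centralBinom := by
      exact_mod_cast succ_mul_catalan_eq_centralBinom N
    have h2 : ((N : ℝ) + 1) * (N + 1).centralBinom = 2 * (2 * N + 1) * N.centralBinom := by
      exact_mod_cast Nat.succ_mul_centralBinom_succ N
    have h3 : ((N + 1).centralBinom : ℝ) = 2 * (2 * N + 1) * catalan N := by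
      have : (N : ℝ) + 1 ≠ 0 := by positivity
      apply mul_left_cancel₀ this
      rw [h2, ← h1]; ring
    rw [h3, ← h1, pow_succ]
    field_simp
    ring

theorem summable_sqrtCoeff : Summable sqrtCoeff :=
  summable_of_sum_range_le (c := 1) sqrtCoeff_nonneg fun N => by
    rw [sum_range_sqrtCoeff]
    linarith [show (0 : ℝ) ≤ N.centralBinom / 4 ^ N by positivity]

theorem tsum_sqrtCoeff_le_one : ∑' n, sqrtCoeff n ≤ 1 :=
  summable_sqrtCoeff.tsum_le_of_sum_range_le fun N => by
    rw [sum_range_sqrtCoeff]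
    linarith [show (0 : ℝ) ≤ N.centralBinom / 4 ^ N by positivity]

variable {X : Type*} [NormedAddCommGroup X] [InnerProductSpace ℝ X] [CompleteSpace X]

/-- For a symmetric contraction `A`, the operator `1 - A` has a non-negative square root. -/
theorem exists_isPositive_sq_eq_one_sub (A : X →L[ℝ] X) (hA : A.IsSymmetric) (hA1 : ‖A‖ ≤ 1) :
    ∃ S : X →L[ℝ] X, S.IsPositive ∧ S * S = 1 - A := by
  have hpow : ∀ n, ‖A ^ (n + 1)‖ ≤ 1 := fun n =>
    (norm_pow_le' A n.succ_pos).trans (pow_le_one₀ (norm_nonneg _) hA1)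
  have hle : ∀ n, ‖sqrtCoeff n • A ^ (n + 1)‖ ≤ sqrtCoeff n := fun n => by
    rw [norm_smul, Real.norm_of_nonneg (sqrtCoeff_nonneg n)]
    exact mul_le_of_le_one_right (sqrtCoeff_nonneg n) (hpow n)
  have hsn : Summable fun n => ‖sqrtCoeff n • A ^ (n + 1)‖ :=
    Summable.of_nonneg_of_le (fun _ => norm_nonneg _) hle summable_sqrtCoeff
  have hs := hsn.of_norm
  set R : X →L[ℝ] X := ∑' n, sqrtCoeff n • A ^ (n + 1) with hR
  -- Equivalent to `(1 - R)² = 1 - A`, so `1 - R` is the square root sought.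
  have hRR : R * R = 2 • R - A := by
    have h1 : R = sqrtCoeff 0 • A + ∑' n, sqrtCoeff (n + 1) • A ^ (n + 2) := by
      rw [hR, hs.tsum_eq_zero_add]; simp
    have h2 : R * R = ∑' n, (2 * sqrtCoeff (n + 1)) • A ^ (n + 2) := by
      rw [hR, tsum_mul_tsum_eq_tsum_sum_antidiagonal_of_summable_norm hsn hsn]
      refine tsum_congr fun n => ?_
      rw [← sum_antidiagonal_sqrtCoeff, Finset.sum_smul]
      refine Finset.sum_congr rfl fun p hp => ?_
      rw [smul_mul_smul_comm, ← pow_add, ← Finset.HasAntidiagonal.mem_antidiagonal.1 hp]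
      congr 2; ring
    simp only [mul_smul, tsum_const_smul'' ] at h2
    rw [h2, h1, sqrtCoeff_zero]
    module
  have hsymm : ∀ n x y, inner ℝ ((A ^ n) x) y = inner ℝ x ((A ^ n) y) := by
    intro n
    induction n with
    | zero => simp
    | succ n ih =>
      intro x y
      rw [pow_succ, mul_apply_eq_comp, ih]
      have := hA x ((A ^ n) y)
      simp only [ContinuousLinearMap.coe_coe] at this
      rw [this, ← mul_apply_eq_comp, ← pow_succ', pow_succ]
  have hRx : ∀ x, HasSum (fun n => sqrtCoeff n • (A ^ (n + 1)) x) (R x) := fun x => by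
    have := (ContinuousLinearMap.apply ℝ X x).hasSum hs.hasSum
    simpa using this
  refine ⟨1 - R, ?_, ?_⟩
  · rw [ContinuousLinearMap.isPositive_def]
    constructor
    · intro x y
      have h1 := (innerSL ℝ y).hasSum (hRx x)
      have h2 := (innerSL ℝ x).hasSum (hRx y)
      have : inner ℝ y (R x) = inner ℝ x (R y) := by
        have e : (fun n => innerSL ℝ y (sqrtCoeff n • (A ^ (n + 1)) x)) =
            fun n => innerSL ℝ x (sqrtCoeff n • (A ^ (n + 1)) y) := by
          funext n
          simp only [innerSL_apply_apply, inner_smul_right]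
          rw [real_inner_comm, hsymm]
        rw [e] at h1
        exact h1.unique h2
      simp only [ContinuousLinearMap.coe_coe, sub_apply,
        one_apply_eq_self, inner_sub_left, inner_sub_right]
      rw [← this, real_inner_comm y (R x)]
    · intro x
      have hRn : ‖R‖ ≤ 1 := (tsum_of_norm_bounded summable_sqrtCoeff.hasSum hle).trans
        tsum_sqrtCoeff_le_one
      have h3 : inner ℝ (R x) x ≤ ‖x‖ * ‖x‖ :=
        (real_inner_le_norm _ _).trans (mul_le_mul_of_nonneg_right
          ((R.le_of_opNorm_le hRn x).trans_eq (one_mul _)) (norm_nonneg _))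
      simp only [ContinuousLinearMap.reApplyInnerSelf_apply, sub_apply,
        one_apply_eq_self, inner_sub_left, RCLike.re_to_real,
        real_inner_self_eq_norm_mul_norm]
      linarith
  · rw [mul_sub, sub_mul, sub_mul, hRR, mul_one, one_mul, mul_one]
    module

/-- Non-negative symmetric operators have non-negative symmetric square roots. -/
theorem exists_isPositive_comp_self_eq {Q : X →L[ℝ] X} (hQ : Q.IsPositive) :
    ∃ S : X →L[ℝ] X, S.IsPositive ∧ S.comp S = Q := by
  rcases eq_or_ne Q 0 with rfl | h0
  · exact ⟨0, ContinuousLinearMap.isPositive_zero, by simp⟩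
  have hc : 0 < ‖Q‖ := norm_pos_iff.2 h0
  set c := ‖Q‖
  -- Cauchy–Schwarz for the semi-inner product `⟨Q x, y⟩` at the pair `x`, `Q x`, then division by
  -- `‖Q x‖²`.
  have hcs : ∀ x, ‖Q x‖ ^ 2 ≤ c * inner ℝ (Q x) x := by
    intro x
    have h := LinearMap.BilinForm.apply_mul_apply_le_of_forall_zero_le
      ((innerₗ X).comp (Q : X →ₗ[ℝ] X)) (fun x => hQ.inner_nonneg_left x) x (Q x)
    simp only [LinearMap.comp_apply, innerₗ_apply_apply, ContinuousLinearMap.coe_coe] at h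
    rw [hQ.inner_left_eq_inner_right (Q x) x, real_inner_self_eq_norm_sq] at h
    have h2 : inner ℝ (Q (Q x)) (Q x) ≤ c * ‖Q x‖ ^ 2 := by
      refine (real_inner_le_norm _ _).trans ?_
      rw [sq, ← mul_assoc]
      exact mul_le_mul_of_nonneg_right (Q.le_opNorm _) (norm_nonneg _)
    have h3 := hQ.inner_nonneg_left x
    rcases (sq_nonneg ‖Q x‖).eq_or_lt with h4 | h4
    · rw [← h4]; positivity
    · nlinarith
  -- Rescaling by `‖Q‖` makes `1 - c⁻¹ Q` a contraction: in the expansion of `‖x - c⁻¹ Q x‖²`, `hcs`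
  -- absorbs the quadratic term into the cross term.
  obtain ⟨S, hS, hSS⟩ := exists_isPositive_sq_eq_one_sub (1 - c⁻¹ • Q) (by
      intro x y
      have := hQ.inner_left_eq_inner_right x y
      simp [inner_sub_left, inner_sub_right, inner_smul_left, inner_smul_right, this]) (by
      refine ContinuousLinearMap.opNorm_le_bound _ zero_le_one fun x => ?_
      rw [one_mul]
      refine le_of_sq_le_sq ?_ (norm_nonneg _)
      simp only [sub_apply, one_apply_eq_self,
        smul_apply]
      rw [norm_sub_sq_real, norm_smul, inner_smul_right, mul_pow, real_inner_comm,
        Real.norm_of_nonneg (by positivity)]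
      have h1 : c⁻¹ ^ 2 * ‖Q x‖ ^ 2 ≤ c⁻¹ * inner ℝ (Q x) x := by
        calc c⁻¹ ^ 2 * ‖Q x‖ ^ 2 ≤ c⁻¹ ^ 2 * (c * inner ℝ (Q x) x) := by gcongr; exact hcs x
          _ = _ := by field_simp
      have h2 : 0 ≤ c⁻¹ * inner ℝ (Q x) x := mul_nonneg (by positivity) (hQ.inner_nonneg_left x)
      linarith)
  refine ⟨Real.sqrt c • S, ?_, ?_⟩
  · exact hS.smul_of_nonneg (Real.sqrt_nonneg _)
  · have : S.comp S = c⁻¹ • Q := by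
      change S * S = _
      rw [hSS]; simp
    rw [ContinuousLinearMap.smul_comp, ContinuousLinearMap.comp_smul, this, smul_smul, smul_smul,
      Real.mul_self_sqrt hc.le, mul_inv_cancel₀ hc.ne', one_smul]

theorem sqrtOp_spec {Q : X →L[ℝ] X} (hQ : Q.IsPositive) :
    (sqrtOp Q).IsPositive ∧ (sqrtOp Q).comp (sqrtOp Q) = Q := by
  have h := exists_isPositive_comp_self_eq hQ
  simpa only [sqrtOp, dif_pos h] using h.choose_spec

end SquareRoot

/-! ### Characteristic functions under `L²` convergence. -/

section CharFun

variable {Ω : Type*} [MeasurableSpace Ω] {P : Measure Ω} [IsProbabilityMeasure P]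

/-- `L²` convergence implies convergence of the characteristic functions. -/
theorem tendsto_integral_cexp_of_tendsto_eLpNorm {ι : Type*} {l : Filter ι} {F : ι → Ω → ℝ}
    {G : Ω → ℝ} (hF : ∀ i, AEStronglyMeasurable (F i) P) (hG : AEStronglyMeasurable G P)
    (h : Tendsto (fun i => eLpNorm (F i - G) 2 P) l (𝓝 0)) :
    Tendsto (fun i => ∫ ω, Complex.exp (F i ω * Complex.I) ∂P) l
      (𝓝 (∫ ω, Complex.exp (G ω * Complex.I) ∂P)) := by
  have hint : ∀ H : Ω → ℝ, AEStronglyMeasurable H P →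
      Integrable (fun ω => Complex.exp (H ω * Complex.I)) P := fun H hH => by
    refine Integrable.of_bound (C := 1) ?_ (Eventually.of_forall fun ω => ?_)
    · exact Complex.continuous_exp.comp_aestronglyMeasurable
        ((Complex.continuous_ofReal.comp_aestronglyMeasurable hH).mul_const _)
    · rw [Complex.norm_exp_ofReal_mul_I]
  refine tendsto_integral_of_L1 _ (hint G hG).aestronglyMeasurable
    (Eventually.of_forall fun i => hint _ (hF i)) ?_
  refine tendsto_of_tendsto_of_tendsto_of_le_of_le tendsto_const_nhds h (fun _ => bot_le)
    fun i => ?_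
  calc ∫⁻ ω, ‖Complex.exp (F i ω * Complex.I) - Complex.exp (G ω * Complex.I)‖ₑ ∂P
      ≤ ∫⁻ ω, ‖(F i - G) ω‖ₑ ∂P := by
        refine lintegral_mono fun ω => ?_
        rw [enorm_le_iff_norm_le]
        -- This reduces `|e^{ia} - e^{ib}| ≤ |a - b|` to the case `b = 0`.
        have h1 : Complex.exp (F i ω * Complex.I) - Complex.exp (G ω * Complex.I) =
            Complex.exp (G ω * Complex.I) * (Complex.exp (Complex.I * (F i ω - G ω : ℝ)) - 1) := by
          rw [mul_sub, ← Complex.exp_add, mul_one]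
          congr 2
          push_cast; ring
        rw [h1, norm_mul, Complex.norm_exp_ofReal_mul_I, one_mul]
        exact Real.norm_exp_I_mul_ofReal_sub_one_le
    _ = eLpNorm (F i - G) 1 P := eLpNorm_one_eq_lintegral_enorm.symm
    _ ≤ eLpNorm (F i - G) 2 P :=
        eLpNorm_le_eLpNorm_of_exponent_le one_le_two ((hF i).sub hG)

end CharFun

/-! ### Existence and uniqueness of Gaussian measures with trace-class covariance. -/

section Existence

/-- The law of a family of independent standard Gaussian variables. -/
noncomputable abbrev gaussianFamily (ι : Type*) : Measure (ι → ℝ) :=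
  Measure.infinitePi fun _ : ι => gaussianReal 0 1

variable {ι : Type*}

theorem measurePreserving_eval_gaussianFamily (i : ι) :
    MeasurePreserving (fun ω : ι → ℝ => ω i) (gaussianFamily ι) (gaussianReal 0 1) :=
  measurePreserving_eval_infinitePi (fun _ : ι => gaussianReal 0 1) i

theorem memLp_eval_gaussianFamily (i : ι) :
    MemLp (fun ω : ι → ℝ => ω i) 2 (gaussianFamily ι) :=
  (memLp_id_gaussianReal' 2 (by simp)).comp_measurePreserving
    (measurePreserving_eval_gaussianFamily i)

theorem iIndepFun_eval_gaussianFamily :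
    iIndepFun (fun i (ω : ι → ℝ) => ω i) (gaussianFamily ι) :=
  iIndepFun_infinitePi (X := fun _ x => x) fun _ => measurable_id

theorem integral_eval_mul_self_gaussianFamily (i : ι) :
    ∫ ω, ω i * ω i ∂(gaussianFamily ι) = 1 := by
  have h := (measurePreserving_eval_gaussianFamily i).map_eq
  have h2 : ∫ x, x * x ∂(gaussianReal 0 1) = 1 := by
    have := variance_fun_id_gaussianReal (μ := 0) (v := 1)
    rw [variance_eq_integral (by fun_prop)] at this
    simpa [sq] using this
  rw [← h2, ← h, integral_map (measurable_pi_apply i).aemeasurable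
    (by fun_prop)]

theorem integral_eval_mul_eval_gaussianFamily {i j : ι} (hij : i ≠ j) :
    ∫ ω, ω i * ω j ∂(gaussianFamily ι) = 0 := by
  have h := (measurePreserving_eval_gaussianFamily i).map_eq
  have h2 : ∫ ω, ω i ∂(gaussianFamily ι) = 0 := by
    rw [← integral_id_gaussianReal (μ := 0) (v := 1), ← h,
      integral_map (measurable_pi_apply i).aemeasurable (by fun_prop)]
  have h3 := (iIndepFun_eval_gaussianFamily.indepFun hij).integral_fun_mul_eq_mul_integral
    (memLp_eval_gaussianFamily i).aestronglyMeasurable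
    (memLp_eval_gaussianFamily j).aestronglyMeasurable
  rw [h3, h2, zero_mul]

theorem integral_cexp_sum_gaussianFamily (J : Finset ι) (c : ι → ℝ) :
    ∫ ω, Complex.exp ((∑ i ∈ J, ω i * c i : ℝ) * Complex.I) ∂(gaussianFamily ι) =
      Complex.exp (-((∑ i ∈ J, c i ^ 2 : ℝ) / 2)) := by
  have hm : ∀ i, Measurable fun ω : ι → ℝ => ω i * c i := fun i => by fun_prop
  have hi : iIndepFun (fun i (ω : ι → ℝ) => ω i * c i) (gaussianFamily ι) :=
    iIndepFun_infinitePi (X := fun i x => x * c i) fun _ => by fun_prop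
  have h1 := congrFun (iIndepFun.charFun_map_fun_finsetSum_eq_prod (s := J)
    (fun i _ => (hm i).aemeasurable) (hi.precomp (g := fun i : J => (i : ι))
      Subtype.val_injective)) 1
  have h2 : ∀ i, charFun ((gaussianFamily ι).map fun ω : ι → ℝ => ω i * c i) 1 =
      Complex.exp (-((c i ^ 2 : ℝ) / 2)) := fun i => by
    have : (fun ω : ι → ℝ => ω i * c i) = (fun x => x * c i) ∘ fun ω => ω i := rfl
    rw [this, ← Measure.map_map (by fun_prop) (by fun_prop),
      (measurePreserving_eval_gaussianFamily i).map_eq, gaussianReal_map_mul_const,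
      charFun_gaussianReal]
    congr 1
    simp
  rw [Finset.prod_apply, Finset.prod_congr rfl fun i _ => h2 i, ← Complex.exp_sum,
    charFun_apply_real, integral_map (Finset.measurable_fun_sum _ fun i _ => hm i).aemeasurable
      (by fun_prop)] at h1
  simp only [Complex.ofReal_one, one_mul] at h1
  rw [h1, Finset.sum_neg_distrib, ← Finset.sum_div]
  push_cast
  rfl

variable {X : Type*} [NormedAddCommGroup X] [InnerProductSpace ℝ X]

theorem memLp_eval_smul_gaussianFamily (i : ι) (x : X) :
    MemLp (fun ω : ι → ℝ => ω i • x) 2 (gaussianFamily ι) :=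
  ((ContinuousLinearMap.id ℝ ℝ).smulRight x).comp_memLp' (memLp_eval_gaussianFamily i)

theorem inner_toLp_eval_smul (i j : ι) (x y : X) :
    inner ℝ (memLp_eval_smul_gaussianFamily i x).toLp (memLp_eval_smul_gaussianFamily j y).toLp =
      (∫ ω, ω i * ω j ∂(gaussianFamily ι)) * inner ℝ x y := by
  rw [L2.inner_def, ← integral_mul_const]
  refine integral_congr_ae ?_
  filter_upwards [(memLp_eval_smul_gaussianFamily i x).coeFn_toLp,
    (memLp_eval_smul_gaussianFamily j y).coeFn_toLp] with ω h1 h2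
  rw [h1, h2, inner_smul_left, inner_smul_right]
  simp [mul_assoc]

/-- Multiplication of vectors by the `i`-th coordinate of a family of independent standard
Gaussian variables, as an isometry into `L²`. -/
noncomputable def gaussianCoord (i : ι) : X →ₗᵢ[ℝ] Lp X 2 (gaussianFamily ι) :=
  LinearMap.isometryOfInner
    { toFun := fun x => (memLp_eval_smul_gaussianFamily i x).toLp
      map_add' := fun x y => by
        rw [← MemLp.toLp_add]
        refine MemLp.toLp_congr _ _ (Eventually.of_forall fun ω => ?_)
        simp
      map_smul' := fun c x => by
        rw [RingHom.id_apply, ← MemLp.toLp_const_smul]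
        refine MemLp.toLp_congr _ _ (Eventually.of_forall fun ω => ?_)
        simp [smul_comm c] }
    fun x y => by
      refine (inner_toLp_eval_smul i i x y).trans ?_
      rw [integral_eval_mul_self_gaussianFamily, one_mul]

theorem gaussianCoord_ae_eq (i : ι) (x : X) :
    gaussianCoord i x =ᵐ[gaussianFamily ι] fun ω => ω i • x :=
  (memLp_eval_smul_gaussianFamily i x).coeFn_toLp

/-- Centred independent coordinates are orthogonal in `L²`. Hence a series `∑ ω_i v_i` of vectors
converges in `L²` as soon as `∑ ‖v_i‖² < ∞`. -/
theorem orthogonalFamily_gaussianCoord :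
    OrthogonalFamily ℝ (fun _ : ι => X) gaussianCoord := fun i j hij x y => by
  refine (inner_toLp_eval_smul i j x y).trans ?_
  rw [integral_eval_mul_eval_gaussianFamily hij, zero_mul]

theorem sum_gaussianCoord_ae_eq (J : Finset ι) (v : ι → X) :
    (∑ i ∈ J, gaussianCoord i (v i) : Lp X 2 (gaussianFamily ι)) =ᵐ[gaussianFamily ι]
      fun ω => ∑ i ∈ J, ω i • v i := by
  classical
  induction J using Finset.induction_on with
  | empty =>
    simp only [Finset.sum_empty]
    exact Lp.coeFn_zero _ _ _
  | insert i J hi ih =>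
    rw [Finset.sum_insert hi]
    filter_upwards [Lp.coeFn_add (gaussianCoord i (v i)) (∑ i ∈ J, gaussianCoord i (v i)), ih,
      gaussianCoord_ae_eq i (v i)] with ω h1 h2 h3
    rw [h1, Pi.add_apply, h2, h3, Finset.sum_insert hi]

variable [CompleteSpace X] [TopologicalSpace.SeparableSpace X] [MeasurableSpace X] [BorelSpace X]

/-- A finite measure with the characteristic function of `N_{m,Q}` is `N_{m,Q}`. -/
theorem isGaussianWith_of_charFun {m : X} {Q : X →L[ℝ] X} (hQ : Q.IsPositive) {μ : Measure X}
    [IsFiniteMeasure μ] (h : ∀ t, charFun μ t =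
      Complex.exp (inner ℝ t m * Complex.I - (inner ℝ (Q t) t : ℝ) / 2)) :
    IsGaussianWith m Q μ := by
  have : SecondCountableTopology X := UniformSpace.secondCountable_of_separable X
  let q : X →L[ℝ] X →L[ℝ] ℝ := (innerSL ℝ).comp Q
  have hq : q.toBilinForm.IsPosSemidef :=
    { eq := fun x y => by
        change inner ℝ (Q x) y = inner ℝ (Q y) x
        rw [hQ.inner_left_eq_inner_right, real_inner_comm]
      nonneg := fun x => hQ.inner_nonneg_left x }
  have hG := gaussian_charFun_congr m q hq h
  refine ⟨isGaussian_iff_gaussian_charFun.2 ⟨m, q, hq, h⟩, hG.1.symm, fun a b => ?_⟩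
  rw [← hG.2]
  rfl

theorem charFun_isGaussianWith {m : X} {Q : X →L[ℝ] X} {μ : Measure X}
    (h : IsGaussianWith m Q μ) (t : X) : charFun μ t =
      Complex.exp (inner ℝ t m * Complex.I - (inner ℝ (Q t) t : ℝ) / 2) := by
  have : SecondCountableTopology X := UniformSpace.secondCountable_of_separable X
  have := h.1
  rw [IsGaussian.charFun_eq', h.2.2]
  simp only [id]
  rw [h.2.1]

/-- The measure is the law of the random series `G = ∑ ω_i Q^{1/2} b_i` with independent standard
Gaussian `ω_i`. The trace of `Q` is `∑ ‖Q^{1/2} b_i‖²`, so finite trace is exactly what makes the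
series converge in `L²`. -/
theorem exists_isGaussianWith_zero {Q : X →L[ℝ] X} (hQ : IsPosTraceClass Q) :
    ∃ μ : Measure X, IsGaussianWith 0 Q μ := by
  have : SecondCountableTopology X := UniformSpace.secondCountable_of_separable X
  obtain ⟨hS, hSS⟩ := sqrtOp_spec hQ.1
  obtain ⟨hQ, w, b, hb⟩ := hQ
  set S := sqrtOp Q
  have hQS : ∀ x y, inner ℝ (Q x) y = inner ℝ (S x) (S y) := fun x y => by
    rw [← hSS, ContinuousLinearMap.comp_apply, hS.inner_left_eq_inner_right]
  have hsum : Summable fun i => gaussianCoord (ι := w) i (S (b i)) := by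
    rw [orthogonalFamily_gaussianCoord.summable_iff_norm_sq_summable (f := fun i => S (b i))]
    refine hb.congr fun i => ?_
    rw [hQS, real_inner_self_eq_norm_sq]
  obtain ⟨G, hG⟩ := hsum
  have hGm := (Lp.aestronglyMeasurable G).aemeasurable
  have : IsProbabilityMeasure ((gaussianFamily w).map G) := Measure.isProbabilityMeasure_map hGm
  refine ⟨(gaussianFamily w).map G, isGaussianWith_of_charFun hQ fun t => ?_⟩
  have hlim : Tendsto (fun J : Finset w => eLpNorm
      ((fun ω => ∑ i ∈ J, ω i * inner ℝ (S (b i)) t) - fun ω => inner ℝ (G ω) t) 2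
        (gaussianFamily w)) atTop (𝓝 0) := by
    have hL := ((innerSL ℝ t).compLpL 2 (gaussianFamily w)).continuous.tendsto G
    have h1 := (Lp.tendsto_Lp_iff_tendsto_eLpNorm' _ _).1 (hL.comp hG)
    refine h1.congr fun J => eLpNorm_congr_ae ?_
    filter_upwards [sum_gaussianCoord_ae_eq J fun i => S (b i),
      (innerSL ℝ t).coeFn_compLpL (p := 2) (∑ i ∈ J, gaussianCoord i (S (b i))),
      (innerSL ℝ t).coeFn_compLpL (p := 2) G] with ω h2 h3 h4
    simp only [Pi.sub_apply, Function.comp_apply]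
    rw [h3, h4, h2]
    simp only [innerSL_apply_apply, inner_sum, inner_smul_right, real_inner_comm t]
  have h3 := tendsto_integral_cexp_of_tendsto_eLpNorm
    (fun J => (Finset.measurable_fun_sum _ fun i _ =>
      (measurable_pi_apply i).mul_const _).aestronglyMeasurable)
    ((Lp.aestronglyMeasurable G).inner aestronglyMeasurable_const) hlim
  have h4 : Tendsto (fun J : Finset w => Complex.exp
      (-((∑ i ∈ J, inner ℝ (S (b i)) t ^ 2 : ℝ) / 2))) atTop
      (𝓝 (Complex.exp (-((inner ℝ (Q t) t : ℝ) / 2)))) := by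
    -- Parseval for `S t`: the variances of the partial sums of `⟨G, t⟩` increase to `‖S t‖² = ⟨Q t,
    -- t⟩`.
    have h5 : HasSum (fun i => inner ℝ (S (b i)) t ^ 2) (inner ℝ (Q t) t) := by
      rw [hQS]
      have h6 := b.hasSum_inner_mul_inner (S t) (S t)
      have e : (fun i => inner ℝ (S (b i)) t ^ 2) =
          fun i => inner ℝ (S t) (b i) * inner ℝ (b i) (S t) := by
        funext i
        rw [hS.inner_left_eq_inner_right, real_inner_comm, sq]
      rw [e]
      exact h6
    refine (Complex.continuous_exp.tendsto _).comp (Tendsto.neg (Tendsto.div_const ?_ 2))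
    exact (Complex.continuous_ofReal.tendsto _).comp h5
  simp only [integral_cexp_sum_gaussianFamily] at h3
  rw [charFun_apply, integral_map hGm (by fun_prop), tendsto_nhds_unique h3 h4]
  simp

theorem IsGaussianWith.map_add_const {Q : X →L[ℝ] X} (hQ : Q.IsPositive) {μ : Measure X}
    (h : IsGaussianWith 0 Q μ) (m : X) : IsGaussianWith m Q (μ.map (· + m)) := by
  have : SecondCountableTopology X := UniformSpace.secondCountable_of_separable X
  have := h.1
  have : IsProbabilityMeasure (μ.map (· + m)) :=
    Measure.isProbabilityMeasure_map (by fun_prop)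
  refine isGaussianWith_of_charFun hQ fun t => ?_
  rw [charFun_map_add_const, charFun_isGaussianWith h, ← Complex.exp_add, inner_zero_right,
    real_inner_comm m t]
  congr 1
  rw [Complex.ofReal_zero, zero_mul]
  ring

theorem IsGaussianWith.unique {m : X} {Q : X →L[ℝ] X} {μ ν : Measure X}
    (hμ : IsGaussianWith m Q μ) (hν : IsGaussianWith m Q ν) : μ = ν := by
  have : SecondCountableTopology X := UniformSpace.secondCountable_of_separable X
  have := hμ.1
  have := hν.1
  refine Measure.ext_of_charFun (funext fun t => ?_)
  rw [charFun_isGaussianWith hμ, charFun_isGaussianWith hν]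

theorem isGaussianWith_gaussian {Q : X →L[ℝ] X} (hQ : IsPosTraceClass Q) (m : X) :
    IsGaussianWith m Q (gaussian m Q) := by
  obtain ⟨μ, hμ⟩ := exists_isGaussianWith_zero hQ
  have h : ∃ μ : Measure X, IsGaussianWith m Q μ := ⟨_, hμ.map_add_const hQ.1 m⟩
  simpa only [gaussian, dif_pos h] using h.choose_spec

/-- The measures for different means are chosen separately; uniqueness ties them together, so every
integral can be taken against the centred measure. -/
theorem gaussian_eq_map_add {Q : X →L[ℝ] X} (hQ : IsPosTraceClass Q) (m : X) :
    gaussian m Q = (gaussian 0 Q).map (· + m) :=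
  (isGaussianWith_gaussian hQ m).unique ((isGaussianWith_gaussian hQ 0).map_add_const hQ.1 m)

end Existence

/-! ### Pairings and the recurrence of the Hermite forms. -/

section Pairings

/-- `i` lists `r` disjoint pairs of indices: in every pair the smaller index comes first, and the
pairs are ordered by their first indices. -/
def IsPairing {n r : ℕ} (i : Fin r × Fin 2 → Fin n) : Prop :=
  Function.Injective i ∧ (∀ k, i (k, 0) < i (k, 1)) ∧ StrictMono fun k => i (k, 0)

open Classical in
/-- The contribution of the pairings with `r` pairs to a Hermite form, for an arbitrary matrix `c`
of weights of the pairs. -/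
noncomputable def pairSum {n : ℕ} (c : Fin n → Fin n → ℝ) (w : Fin n → ℝ) (r : ℕ) : ℝ :=
  ∑ i : Fin r × Fin 2 → Fin n with IsPairing i,
    (∏ k, c (i (k, 0)) (i (k, 1))) * ∏ m with m ∉ Set.range i, w m

open Classical in
/-- The partial derivative of `pairSum c w r` with respect to `w j`. -/
noncomputable def pairSumDeriv {n : ℕ} (c : Fin n → Fin n → ℝ) (w : Fin n → ℝ) (r : ℕ)
    (j : Fin n) : ℝ :=
  ∑ i : Fin r × Fin 2 → Fin n with IsPairing i ∧ j ∉ Set.range i,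
    (∏ k, c (i (k, 0)) (i (k, 1))) * ∏ m with m ∉ Set.range i ∧ m ≠ j, w m

theorem IsPairing.two_mul_le {n r : ℕ} {i : Fin r × Fin 2 → Fin n} (h : IsPairing i) :
    2 * r ≤ n := by
  have := Fintype.card_le_of_injective i h.1
  simp only [Fintype.card_prod, Fintype.card_fin] at this
  lia

theorem pairSum_eq_zero {n r : ℕ} (c : Fin n → Fin n → ℝ) (w : Fin n → ℝ) (h : n < 2 * r) :
    pairSum c w r = 0 := by
  classical
  exact Finset.sum_eq_zero fun i hi =>
    absurd (Finset.mem_filter.1 hi).2.two_mul_le (by lia)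

theorem isPairing_of_fin_zero {n : ℕ} (i : Fin 0 × Fin 2 → Fin n) : IsPairing i :=
  ⟨fun a => a.1.elim0, fun k => k.elim0, fun k => k.elim0⟩

theorem pairSum_zero {n : ℕ} (c : Fin n → Fin n → ℝ) (w : Fin n → ℝ) :
    pairSum c w 0 = ∏ m, w m := by
  classical
  have : (Finset.univ.filter fun i : Fin 0 × Fin 2 → Fin n => IsPairing i) =
      {fun a => a.1.elim0} := by
    ext i
    simp only [Finset.mem_filter, Finset.mem_univ, true_and, Finset.mem_singleton,
      isPairing_of_fin_zero, true_iff]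
    exact funext fun a => a.1.elim0
  rw [pairSum, this, Finset.sum_singleton, Finset.univ_eq_empty, Finset.prod_empty, one_mul]
  refine Finset.prod_congr (Finset.filter_true_of_mem fun m _ => ?_) fun _ _ => rfl
  rintro ⟨a, -⟩
  exact a.1.elim0

variable {X : Type*} [NormedAddCommGroup X] [InnerProductSpace ℝ X]

/-- The leading product is the term `r = 0`, and terms with `2r > n` vanish. The free cut-off `N`
lets forms of orders `n` and `n + 1` be compared without parity cases for `n / 2`. -/
theorem hermiteForm_eq_sum_pairSum [CompleteSpace X] {n : ℕ} (a : Fin n → X) (w : Fin n → ℝ) {N : ℕ}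
    (hN : n < 2 * N) :
    hermiteForm a w =
      ∑ r ∈ Finset.range N, (-1 : ℝ) ^ r * pairSum (fun p q => inner ℝ (a p) (a q)) w r := by
  classical
  have h1 : hermiteForm a w = ∑ r ∈ Finset.range (n / 2 + 1),
      (-1 : ℝ) ^ r * pairSum (fun p q => inner ℝ (a p) (a q)) w r := by
    rw [Finset.sum_range_succ', pow_zero, one_mul, pairSum_zero, hermiteForm, add_comm]
    congr 1
    rw [← Finset.Ico_add_one_right_eq_Icc, Finset.sum_Ico_eq_sum_range]
    refine Finset.sum_congr (by simp) fun r _ => ?_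
    rw [add_comm 1 r]
    congr 1
    unfold pairSum IsPairing
    congr!
  rw [h1]
  refine Finset.sum_subset (fun r hr => ?_) fun r _ hr => ?_
  · rw [Finset.mem_range] at hr ⊢; lia
  · rw [pairSum_eq_zero, mul_zero]
    rw [Finset.mem_range] at hr; lia

/-- The pairing on `Fin (n + 1)` made of the pair `(0, j + 1)` and of the shifted pairs of `i`. -/
def consPair {n r : ℕ} (i : Fin r × Fin 2 → Fin n) (j : Fin n) :
    Fin (r + 1) × Fin 2 → Fin (n + 1) :=
  fun p => Fin.cases (if p.2 = 0 then 0 else j.succ) (fun k => (i (k, p.2)).succ) p.1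

@[simp] theorem consPair_zero_zero {n r : ℕ} (i : Fin r × Fin 2 → Fin n) (j : Fin n) :
    consPair i j (0, 0) = 0 := rfl

@[simp] theorem consPair_zero_one {n r : ℕ} (i : Fin r × Fin 2 → Fin n) (j : Fin n) :
    consPair i j (0, 1) = j.succ := rfl

@[simp] theorem consPair_succ {n r : ℕ} (i : Fin r × Fin 2 → Fin n) (j : Fin n) (k : Fin r)
    (e : Fin 2) : consPair i j (k.succ, e) = (i (k, e)).succ := rfl

theorem zero_mem_range_consPair {n r : ℕ} (i : Fin r × Fin 2 → Fin n) (j : Fin n) :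
    0 ∈ Set.range (consPair i j) := ⟨(0, 0), rfl⟩

theorem succ_mem_range_consPair {n r : ℕ} (i : Fin r × Fin 2 → Fin n) (j m : Fin n) :
    m.succ ∈ Set.range (consPair i j) ↔ m ∈ Set.range i ∨ m = j := by
  constructor
  · rintro ⟨⟨k, e⟩, h⟩
    refine Fin.cases (fun h => ?_) (fun k h => ?_) k h
    · fin_cases e
      · exact absurd h (Fin.succ_ne_zero m).symm
      · exact Or.inr (Fin.succ_injective _ h).symm
    · exact Or.inl ⟨(k, e), Fin.succ_injective _ h⟩
  · rintro (⟨⟨k, e⟩, rfl⟩ | rfl)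
    · exact ⟨(k.succ, e), rfl⟩
    · exact ⟨(0, 1), rfl⟩

theorem consPair_injective {n r : ℕ} {i i' : Fin r × Fin 2 → Fin n} {j j' : Fin n}
    (h : consPair i j = consPair i' j') : i = i' ∧ j = j' :=
  ⟨funext fun p => Fin.succ_injective _ (congrFun h (p.1.succ, p.2)),
    Fin.succ_injective _ (congrFun h (0, 1))⟩

theorem IsPairing.consPair {n r : ℕ} {i : Fin r × Fin 2 → Fin n} (hi : IsPairing i) {j : Fin n}
    (hj : j ∉ Set.range i) : IsPairing (consPair i j) := by
  refine ⟨?_, ?_, ?_⟩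
  · rintro ⟨k, e⟩ ⟨k', e'⟩ h
    induction k using Fin.cases with
    | zero =>
      induction k' using Fin.cases with
      | zero =>
        fin_cases e <;> fin_cases e' <;> simp_all [Fin.succ_ne_zero, eq_comm]
      | succ k' =>
        exfalso
        fin_cases e
        · exact Fin.succ_ne_zero _ h.symm
        · exact hj ⟨(k', e'), (Fin.succ_injective _ h).symm⟩
    | succ k =>
      induction k' using Fin.cases with
      | zero =>
        exfalso
        fin_cases e'
        · simp [Fin.succ_ne_zero] at h
        · exact hj ⟨(k, e), Fin.succ_injective _ h⟩
      | succ k' =>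
        have := hi.1 (Fin.succ_injective _ h)
        simp_all
  · intro k
    induction k using Fin.cases with
    | zero => exact Fin.succ_pos j
    | succ k => exact Fin.succ_lt_succ_iff.2 (hi.2.1 k)
  · intro k k' h
    induction k' using Fin.cases with
    | zero => exact absurd h (Fin.not_lt_zero _)
    | succ k' =>
      induction k using Fin.cases with
      | zero => exact Fin.succ_pos _
      | succ k => exact Fin.succ_lt_succ_iff.2 (hi.2.2 (Fin.succ_lt_succ_iff.1 h))

/-- The ordering conventions leave only one place for the index `0`: it is the smaller element of
its pair, and that pair comes first. Removing the pair and shifting the indices down gives `i'`,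
with `j` the former partner of `0`. -/
theorem IsPairing.exists_eq_consPair {n r : ℕ} {i : Fin (r + 1) × Fin 2 → Fin (n + 1)}
    (hi : IsPairing i) (h0 : 0 ∈ Set.range i) :
    ∃ (i' : Fin r × Fin 2 → Fin n) (j : Fin n),
      IsPairing i' ∧ j ∉ Set.range i' ∧ i = NonautonomousOU.consPair i' j := by
  have h00 : i (0, 0) = 0 := by
    obtain ⟨⟨k, e⟩, hk⟩ := h0
    have hk0 : i (k, 0) = 0 := by
      fin_cases e
      · exact hk
      · have := hi.2.1 k
        simp only [Fin.mk_one] at hk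
        rw [hk] at this
        exact absurd this (Fin.not_lt_zero _)
    have := hi.2.2.monotone (Fin.zero_le k)
    simp only [hk0] at this
    exact Fin.le_zero_iff.1 this
  have hne : ∀ p, p ≠ (0, 0) → i p ≠ 0 := fun p hp h => hp (hi.1 (h.trans h00.symm))
  have hs : ∀ k : Fin r, ∀ e, ((k.succ, e) : Fin (r + 1) × Fin 2) ≠ (0, 0) := fun k e h =>
    Fin.succ_ne_zero k (congrArg Prod.fst h)
  have h1 : ((0, 1) : Fin (r + 1) × Fin 2) ≠ (0, 0) := by simp
  refine ⟨fun p => (i (p.1.succ, p.2)).pred (hne _ (hs _ _)), (i (0, 1)).pred (hne _ h1),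
    ⟨?_, ?_, ?_⟩, ?_, ?_⟩
  · rintro ⟨k, e⟩ ⟨k', e'⟩ h
    have := hi.1 (Fin.pred_inj.1 h)
    simp_all
  · intro k
    exact Fin.pred_lt_pred_iff.2 (hi.2.1 k.succ)
  · intro k k' h
    exact Fin.pred_lt_pred_iff.2 (hi.2.2 (Fin.succ_lt_succ_iff.2 h))
  · rintro ⟨⟨k, e⟩, h⟩
    have := hi.1 (Fin.pred_inj.1 h)
    exact Fin.succ_ne_zero k (congrArg Prod.fst this)
  · funext ⟨k, e⟩
    induction k using Fin.cases with
    | zero =>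
      fin_cases e
      · exact h00
      · simp
    | succ k => simp

/-- Split by whether `0` is paired. If not, it contributes `w 0` and the pairing lives on the
shifted indices; if it is paired with `j + 1`, what remains is a pairing avoiding `j` with the
factor `w (j + 1)` deleted, that is a partial derivative. -/
theorem pairSum_succ {n : ℕ} (c : Fin (n + 1) → Fin (n + 1) → ℝ) (w : Fin (n + 1) → ℝ) (r : ℕ) :
    pairSum c w (r + 1) =
      w 0 * pairSum (fun p q => c p.succ q.succ) (fun p => w p.succ) (r + 1) +
      ∑ j : Fin n, c 0 j.succ *
        pairSumDeriv (fun p q => c p.succ q.succ) (fun p => w p.succ) r j := by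
  classical
  unfold pairSum
  rw [← Finset.sum_filter_add_sum_filter_not _ (fun i => 0 ∉ Set.range i)]
  congr 1
  · rw [Finset.mul_sum, Finset.filter_filter]
    symm
    refine Finset.sum_nbij (fun i p => (i p).succ) ?_ ?_ ?_ ?_
    · intro i hi
      simp only [Finset.mem_filter, Finset.mem_univ, true_and] at hi ⊢
      refine ⟨⟨fun p q h => hi.1 (Fin.succ_injective _ h),
        fun k => Fin.succ_lt_succ_iff.2 (hi.2.1 k),
        fun k k' h => Fin.succ_lt_succ_iff.2 (hi.2.2 h)⟩, ?_⟩
      rintro ⟨p, hp⟩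
      exact Fin.succ_ne_zero _ hp
    · intro i _ i' _ h
      exact funext fun p => Fin.succ_injective _ (congrFun h p)
    · intro i hi
      simp only [Finset.coe_filter, Finset.mem_univ, true_and, Set.mem_ofPred_eq,
        Set.mem_image] at hi ⊢
      have hne : ∀ p, i p ≠ 0 := fun p hp => hi.2 ⟨p, hp⟩
      refine ⟨fun p => (i p).pred (hne p), ⟨fun p q h => hi.1.1 (Fin.pred_inj.1 h),
        fun k => Fin.pred_lt_pred_iff.2 (hi.1.2.1 k),
        fun k k' h => Fin.pred_lt_pred_iff.2 (hi.1.2.2 h)⟩, by simp⟩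
    · intro i _
      rw [mul_left_comm]
      congr 1
      rw [Finset.prod_filter, Finset.prod_filter, Fin.prod_univ_succ]
      congr 1
      · rw [if_pos]
        rintro ⟨p, hp⟩
        exact Fin.succ_ne_zero _ hp
      · refine Finset.prod_congr rfl fun m _ => ?_
        have : m.succ ∈ Set.range (fun p => (i p).succ) ↔ m ∈ Set.range i := by
          simp [Set.mem_range]
        simp only [this]
  · simp only [pairSumDeriv, Finset.mul_sum]
    rw [Finset.filter_filter, Finset.sum_sigma']
    symm
    refine Finset.sum_nbij (fun p => consPair p.2 p.1) ?_ ?_ ?_ ?_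
    · rintro ⟨j, i⟩ h
      simp only [Finset.mem_sigma, Finset.mem_filter, Finset.mem_univ, true_and, not_not] at h ⊢
      exact ⟨h.1.consPair h.2, zero_mem_range_consPair i j⟩
    · rintro ⟨j, i⟩ _ ⟨j', i'⟩ _ h
      obtain ⟨rfl, rfl⟩ := consPair_injective h
      rfl
    · intro i hi
      simp only [Finset.coe_filter, Finset.mem_univ, true_and, Set.mem_ofPred_eq, not_not] at hi
      obtain ⟨i', j, h1, h2, rfl⟩ := hi.1.exists_eq_consPair hi.2
      exact ⟨⟨j, i'⟩, Finset.mem_coe.2 (Finset.mem_sigma.2 ⟨Finset.mem_univ _,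
        Finset.mem_filter.2 ⟨Finset.mem_univ _, h1, h2⟩⟩), rfl⟩
    · rintro ⟨j, i⟩ _
      dsimp only
      rw [Fin.prod_univ_succ, Finset.prod_filter, Finset.prod_filter (s := Finset.univ),
        Fin.prod_univ_succ, if_neg (not_not.2 (zero_mem_range_consPair i j)), one_mul, mul_assoc]
      congr 1
      congr 1
      refine Finset.prod_congr rfl fun m _ => ?_
      simp only [succ_mem_range_consPair, not_or, ne_eq]

theorem hasDerivAt_pairSum {n : ℕ} (c : Fin n → Fin n → ℝ) (r : ℕ) {w : ℝ → Fin n → ℝ}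
    {u : Fin n → ℝ} {x : ℝ} (hw : ∀ m, HasDerivAt (fun e => w e m) (u m) x) :
    HasDerivAt (fun e => pairSum c (w e) r) (∑ j, u j * pairSumDeriv c (w x) r j) x := by
  classical
  have h1 : ∑ j, u j * pairSumDeriv c (w x) r j =
      ∑ i : Fin r × Fin 2 → Fin n with IsPairing i, (∏ k, c (i (k, 0)) (i (k, 1))) *
        ∑ j with j ∉ Set.range i, (∏ m ∈ (Finset.univ.filter fun m => m ∉ Set.range i).erase j,
          w x m) • u j := by
    simp only [pairSumDeriv, Finset.mul_sum, Finset.sum_filter]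
    rw [Finset.sum_comm]
    refine Finset.sum_congr rfl fun i _ => ?_
    by_cases hi : IsPairing i
    · simp only [hi, true_and, if_true]
      refine Finset.sum_congr rfl fun j _ => ?_
      by_cases hj : j ∉ Set.range i
      · rw [if_pos hj, if_pos hj]
        have : (Finset.univ.filter fun m => m ∉ Set.range i).erase j =
            Finset.univ.filter fun m => m ∉ Set.range i ∧ m ≠ j := by
          ext m; simp [and_comm]
        rw [this, smul_eq_mul]; ring
      · rw [if_neg hj, if_neg hj, mul_zero, mul_zero]
    · simp [hi]
  rw [h1]
  unfold pairSum
  refine HasDerivAt.fun_sum fun i _ => HasDerivAt.const_mul _ ?_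
  exact HasDerivAt.fun_finsetProd fun m _ => hw m

/-- The recurrence of the Hermite forms, in differential form. -/
theorem hasDerivAt_hermiteForm [CompleteSpace X] {n : ℕ} (k : X) (a : Fin n → X) (v : ℝ)
    {w : ℝ → Fin n → ℝ} {x : ℝ} (hw : ∀ m, HasDerivAt (fun e => w e m) (-inner ℝ k (a m)) x) :
    HasDerivAt (fun e => hermiteForm a (w e))
      (hermiteForm (Fin.cons k a : Fin (n + 1) → X) (Fin.cons v (w x) : Fin (n + 1) → ℝ) -
        v * hermiteForm a (w x)) x := by
  set c : Fin n → Fin n → ℝ := fun p q => inner ℝ (a p) (a q) with hc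
  have h1 : ∀ e, hermiteForm a (w e) =
      ∑ r ∈ Finset.range (n + 1), (-1 : ℝ) ^ r * pairSum c (w e) r :=
    fun e => hermiteForm_eq_sum_pairSum a (w e) (by lia)
  have h2 : HasDerivAt (fun e => ∑ r ∈ Finset.range (n + 1), (-1 : ℝ) ^ r * pairSum c (w e) r)
      (∑ r ∈ Finset.range (n + 1), (-1 : ℝ) ^ r *
        ∑ j, (-inner ℝ k (a j)) * pairSumDeriv c (w x) r j) x :=
    HasDerivAt.fun_sum fun r _ => (hasDerivAt_pairSum c r hw).const_mul _
  simp only [h1]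
  convert h2 using 1
  -- The cut-off is `n + 2`, so that splitting off `r = 0` leaves `n + 1` terms, matching the sum
  -- for the derivative. The shift `r + 1` supplies the sign carried there by `-⟨k, a_j⟩`.
  rw [hermiteForm_eq_sum_pairSum _ _ (show n + 1 < 2 * (n + 2) by lia), Finset.sum_range_succ']
  simp only [pairSum_succ, pairSum_zero, Fin.cons_zero, Fin.cons_succ, Fin.prod_univ_succ]
  change (∑ r ∈ Finset.range (n + 1), (-1 : ℝ) ^ (r + 1) * (v * pairSum c (w x) (r + 1) +
    ∑ j, inner ℝ k (a j) * pairSumDeriv c (w x) r j)) + _ - _ = _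
  rw [Finset.mul_sum, Finset.sum_range_succ' (fun r => v * ((-1 : ℝ) ^ r * pairSum c (w x) r)),
    pairSum_zero]
  simp only [mul_add, Finset.sum_add_distrib]
  have h3 : ∑ r ∈ Finset.range (n + 1), (-1 : ℝ) ^ (r + 1) * (v * pairSum c (w x) (r + 1)) =
      ∑ r ∈ Finset.range n, v * ((-1 : ℝ) ^ (r + 1) * pairSum c (w x) (r + 1)) := by
    rw [Finset.sum_range_succ, pairSum_eq_zero c (w x) (show n < 2 * (n + 1) by lia), mul_zero,
      mul_zero, add_zero]
    exact Finset.sum_congr rfl fun r _ => by ring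
  have h4 : ∑ r ∈ Finset.range (n + 1), (-1 : ℝ) ^ (r + 1) *
      ∑ j, inner ℝ k (a j) * pairSumDeriv c (w x) r j =
      ∑ r ∈ Finset.range (n + 1), (-1 : ℝ) ^ r *
        ∑ j, (-inner ℝ k (a j)) * pairSumDeriv c (w x) r j := by
    refine Finset.sum_congr rfl fun r _ => ?_
    simp only [neg_mul, Finset.sum_neg_distrib, pow_succ]
    ring
  rw [h3, h4]
  ring

/-- An upper bound for the number of terms of a Hermite form. -/
def hermiteCount (n : ℕ) : ℕ :=
  ∑ r ∈ Finset.range (n + 1), Fintype.card (Fin r × Fin 2 → Fin n)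

theorem hermiteCount_pos (n : ℕ) : 0 < hermiteCount n :=
  Finset.sum_pos' (fun _ _ => Nat.zero_le _) ⟨0, by simp, by simp⟩

/-- By Cauchy–Schwarz on the pairs, each index contributes either `‖a m‖` or `|w m|` exactly once,
so every term is bounded by the same product. -/
theorem abs_pairSum_le {n : ℕ} (a : Fin n → X) (w : Fin n → ℝ) (r : ℕ) :
    |pairSum (fun p q => inner ℝ (a p) (a q)) w r| ≤
      Fintype.card (Fin r × Fin 2 → Fin n) * ∏ m, (‖a m‖ + |w m|) := by
  classical
  have h0 : ∀ m, 0 ≤ ‖a m‖ + |w m| := fun m => by positivity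
  refine (Finset.abs_sum_le_sum_abs _ _).trans ?_
  refine (Finset.sum_le_card_nsmul _ _ (∏ m, (‖a m‖ + |w m|)) fun i hi => ?_).trans ?_
  · have hi := (Finset.mem_filter.1 hi).2
    have h1 : ∏ k, |(inner ℝ (a (i (k, 0))) (a (i (k, 1))) : ℝ)| ≤
        ∏ m with m ∈ Set.range i, (‖a m‖ + |w m|) := by
      have h2 : ∏ m with m ∈ Set.range i, (‖a m‖ + |w m|) =
          ∏ k, ((‖a (i (k, 0))‖ + |w (i (k, 0))|) * (‖a (i (k, 1))‖ + |w (i (k, 1))|)) := by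
        have : (Finset.univ.filter fun m => m ∈ Set.range i) = Finset.univ.image i := by
          ext m; simp only [Finset.mem_filter, Finset.mem_univ, true_and, Set.mem_range,
            Finset.mem_image]
        rw [this, Finset.prod_image (fun p _ q _ h => hi.1 h), Fintype.prod_prod_type]
        simp only [Fin.prod_univ_two]
      rw [h2]
      refine Finset.prod_le_prod (fun _ _ => abs_nonneg _) fun k _ => ?_
      refine (abs_real_inner_le_norm _ _).trans (mul_le_mul ?_ ?_ (norm_nonneg _) (h0 _))
      · exact le_add_of_nonneg_right (abs_nonneg _)
      · exact le_add_of_nonneg_right (abs_nonneg _)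
    rw [abs_mul, Finset.abs_prod, Finset.abs_prod,
      ← Finset.prod_filter_mul_prod_filter_not Finset.univ (fun m => m ∈ Set.range i)
        (fun m => ‖a m‖ + |w m|)]
    refine mul_le_mul h1 (Finset.prod_le_prod (fun _ _ => abs_nonneg _) fun m _ => ?_)
      (Finset.prod_nonneg fun _ _ => abs_nonneg _) (Finset.prod_nonneg fun m _ => h0 m)
    exact le_add_of_nonneg_left (norm_nonneg _)
  · rw [nsmul_eq_mul]
    refine mul_le_mul_of_nonneg_right ?_ (Finset.prod_nonneg fun m _ => h0 m)
    exact_mod_cast Finset.card_le_univ _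

theorem abs_hermiteForm_le [CompleteSpace X] {n : ℕ} (a : Fin n → X) (w : Fin n → ℝ) :
    |hermiteForm a w| ≤ hermiteCount n * ∏ m, (‖a m‖ + |w m|) := by
  rw [hermiteForm_eq_sum_pairSum a w (show n < 2 * (n + 1) by lia), hermiteCount, Nat.cast_sum,
    Finset.sum_mul]
  refine (Finset.abs_sum_le_sum_abs _ _).trans (Finset.sum_le_sum fun r _ => ?_)
  rw [abs_mul, abs_pow, abs_neg, abs_one, one_pow, one_mul]
  exact abs_pairSum_le a w r

theorem continuous_hermiteForm [CompleteSpace X] {n : ℕ} (a : Fin n → X) :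
    Continuous (hermiteForm a) := by
  unfold hermiteForm
  fun_prop

theorem hermiteForm_fin_zero [CompleteSpace X] (a : Fin 0 → X) (w : Fin 0 → ℝ) :
    hermiteForm a w = 1 := by
  simp [hermiteForm]

theorem hermiteForm_fin_one [CompleteSpace X] (a : Fin 1 → X) (w : Fin 1 → ℝ) :
    hermiteForm a w = w 0 := by
  simp [hermiteForm]

end Pairings

/-! ### Isonormal families: exponential and product moments. -/

section Isonormal

variable {X : Type*} [NormedAddCommGroup X] [InnerProductSpace ℝ X]
  {Ω : Type*} [MeasurableSpace Ω] {γ : Measure Ω} {Λ : X →L[ℝ] X} {W : X → Ω → ℝ}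

/-- `W` is a linear family of centred Gaussian variables, the variance of `W x` being `‖Λ x‖²`. -/
structure IsIsonormal (γ : Measure Ω) (Λ : X →L[ℝ] X) (W : X → Ω → ℝ) : Prop where
  law : ∀ x, γ.map (W x) = gaussianReal 0 (‖Λ x‖₊ ^ 2)
  add : ∀ x y, W (x + y) =ᵐ[γ] fun ω => W x ω + W y ω
  smul : ∀ (c : ℝ) x, W (c • x) =ᵐ[γ] fun ω => c * W x ω

namespace IsIsonormal

theorem aemeasurable (hW : IsIsonormal γ Λ W) (x : X) : AEMeasurable (W x) γ :=
  aemeasurable_of_map_neZero (by rw [hW.law]; infer_instance)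

theorem isProbabilityMeasure (hW : IsIsonormal γ Λ W) : IsProbabilityMeasure γ := by
  have : IsProbabilityMeasure (γ.map (W 0)) := by rw [hW.law]; infer_instance
  exact Measure.isProbabilityMeasure_of_map (W 0)

theorem integrable_exp_mul (hW : IsIsonormal γ Λ W) (c : ℝ) (x : X) :
    Integrable (fun ω => Real.exp (c * W x ω)) γ := by
  have h := integrable_exp_mul_gaussianReal (μ := 0) (v := ‖Λ x‖₊ ^ 2) c
  rw [← hW.law x] at h
  exact h.comp_aemeasurable (hW.aemeasurable x)

theorem integral_exp_mul (hW : IsIsonormal γ Λ W) (c : ℝ) (x : X) :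
    ∫ ω, Real.exp (c * W x ω) ∂γ = Real.exp (‖Λ x‖ ^ 2 * c ^ 2 / 2) := by
  have := mgf_gaussianReal (hW.law x) c
  simpa [mgf] using this

theorem exp_mul_abs_le (c y : ℝ) :
    Real.exp (c * |y|) ≤ Real.exp (c * y) + Real.exp (-c * y) := by
  rcases abs_choice y with h | h <;> rw [h]
  · linarith [Real.exp_pos (-c * y)]
  · rw [mul_neg, ← neg_mul]
    linarith [Real.exp_pos (c * y)]

theorem integrable_exp_mul_abs (hW : IsIsonormal γ Λ W) (c : ℝ) (x : X) :
    Integrable (fun ω => Real.exp (c * |W x ω|)) γ := by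
  refine ((hW.integrable_exp_mul c x).add (hW.integrable_exp_mul (-c) x)).mono' ?_
    (Eventually.of_forall fun ω => ?_)
  · have := hW.aemeasurable x
    exact AEMeasurable.aestronglyMeasurable (by fun_prop)
  · rw [Real.norm_of_nonneg (Real.exp_pos _).le]
    exact exp_mul_abs_le c _

theorem integral_exp_mul_abs_le (hW : IsIsonormal γ Λ W) (c : ℝ) (x : X) :
    ∫ ω, Real.exp (c * |W x ω|) ∂γ ≤ 2 * Real.exp (‖Λ x‖ ^ 2 * c ^ 2 / 2) := by
  have h := integral_mono (hW.integrable_exp_mul_abs c x)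
    ((hW.integrable_exp_mul c x).add (hW.integrable_exp_mul (-c) x))
    (fun ω => exp_mul_abs_le c (W x ω))
  refine h.trans_eq ?_
  simp only [Pi.add_apply]
  rw [integral_add (hW.integrable_exp_mul c x) (hW.integrable_exp_mul (-c) x),
    hW.integral_exp_mul, hW.integral_exp_mul, neg_sq]
  ring

/-- A substitute for Hölder: the sum is at most `s.card` times its largest term, so no joint law is
needed. The `1` covers the empty sum. -/
theorem exp_sum_le {ι : Type*} (s : Finset ι) (y : ι → ℝ) :
    Real.exp (∑ i ∈ s, y i) ≤ 1 + ∑ i ∈ s, Real.exp (s.card * y i) := by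
  rcases s.eq_empty_or_nonempty with rfl | hs
  · simp
  obtain ⟨j, hj, hmax⟩ := s.exists_max_image y hs
  have h1 : ∑ i ∈ s, y i ≤ s.card * y j := by
    simpa using Finset.sum_le_card_nsmul s y (y j) hmax
  have h2 := Finset.single_le_sum (f := fun i => Real.exp (s.card * y i))
    (fun i _ => (Real.exp_pos _).le) hj
  linarith [Real.exp_le_exp.2 h1]

theorem integrable_exp_sum_abs (hW : IsIsonormal γ Λ W) {ι : Type*} (s : Finset ι) (g : ι → X) :
    Integrable (fun ω => Real.exp (∑ i ∈ s, |W (g i) ω|)) γ := by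
  have := hW.isProbabilityMeasure
  refine ((integrable_const (1 : ℝ)).add (integrable_finsetSum s fun i _ =>
    hW.integrable_exp_mul_abs s.card (g i))).mono' ?_ (Eventually.of_forall fun ω => ?_)
  · have := fun i => hW.aemeasurable (g i)
    exact AEMeasurable.aestronglyMeasurable (by fun_prop)
  · rw [Real.norm_of_nonneg (Real.exp_pos _).le]
    simpa using exp_sum_le s fun i => |W (g i) ω|

theorem ae_eq_zero (hW : IsIsonormal γ Λ W) {x : X} (hx : Λ x = 0) : W x =ᵐ[γ] 0 := by
  have h := hW.law x
  rw [hx] at h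
  simp only [nnnorm_zero, ne_eq, OfNat.ofNat_ne_zero, not_false_eq_true, zero_pow,
    gaussianReal_zero_var] at h
  have h2 : ∀ᵐ y ∂(γ.map (W x)), y = 0 := by rw [h]; simp [ae_dirac_eq]
  exact ae_of_ae_map (hW.aemeasurable x) h2

/-- The constant in the moment bound, with a free parameter `R`. -/
noncomputable def momentConst (n : ℕ) (R : ℝ) : ℝ :=
  (n + 1) * (n.factorial * (2 * Real.exp (R + R ^ 2 / 2)) / R ^ n)

theorem prod_le_sum_pow {n : ℕ} (hn : n ≠ 0) (y : Fin n → ℝ) (hy : ∀ m, 0 ≤ y m) :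
    ∏ m, y m ≤ ∑ m, y m ^ n := by
  obtain ⟨j, -, hmax⟩ := Finset.univ.exists_max_image y
    ⟨⟨0, Nat.pos_of_ne_zero hn⟩, Finset.mem_univ _⟩
  have h1 : ∏ m, y m ≤ y j ^ n := by
    simpa using Finset.prod_le_prod (s := Finset.univ) (fun m _ => hy m) hmax
  exact h1.trans (Finset.single_le_sum (f := fun m => y m ^ n) (fun m _ => pow_nonneg (hy m) n)
    (Finset.mem_univ j))

theorem integrable_prod_norm_add_abs (hW : IsIsonormal γ Λ W) {n : ℕ} (h : Fin n → X) :
    Integrable (fun ω => ∏ m, (‖Λ (h m)‖ + |W (h m) ω|)) γ := by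
  refine ((hW.integrable_exp_sum_abs Finset.univ h).const_mul
    (Real.exp (∑ m, ‖Λ (h m)‖))).mono' ?_ (Eventually.of_forall fun ω => ?_)
  · have := fun i => hW.aemeasurable (h i)
    exact AEMeasurable.aestronglyMeasurable (by fun_prop)
  · rw [Real.norm_of_nonneg (Finset.prod_nonneg fun m _ => by positivity), ← Real.exp_add,
      ← Finset.sum_add_distrib, Real.exp_sum]
    refine Finset.prod_le_prod (fun m _ => by positivity) fun m _ => ?_
    linarith [Real.add_one_le_exp (‖Λ (h m)‖ + |W (h m) ω|)]

/-- After normalising by `‖Λ (h m)‖`, the product is at most a sum of `n`-th powers, and `(R z)^n /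
n! ≤ exp (R z)` reduces these to exponential moments. A free `R` matters: after division by `n!`,
the constant decays like `(n + 1) R^{-n}`, for any prescribed `R`. -/
theorem integral_prod_norm_add_abs_le (hW : IsIsonormal γ Λ W) {n : ℕ} (h : Fin n → X) {R : ℝ}
    (hR : 0 < R) :
    ∫ ω, ∏ m, (‖Λ (h m)‖ + |W (h m) ω|) ∂γ ≤ momentConst n R * ∏ m, ‖Λ (h m)‖ := by
  have := hW.isProbabilityMeasure
  -- The normalisation needs nonzero norms. If `Λ (h j) = 0`, the variable `W (h j)` is almost
  -- surely zero and so are both sides.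
  by_cases h0 : ∃ j, Λ (h j) = 0
  · obtain ⟨j, hj⟩ := h0
    rw [Finset.prod_eq_zero (Finset.mem_univ j) (by rw [hj, norm_zero]), mul_zero,
      integral_eq_zero_of_ae]
    filter_upwards [hW.ae_eq_zero hj] with ω hω
    exact Finset.prod_eq_zero (Finset.mem_univ j) (by rw [hj, hω]; simp)
  push Not at h0
  have ha : ∀ m, 0 < ‖Λ (h m)‖ := fun m => norm_pos_iff.2 (h0 m)
  rcases eq_or_ne n 0 with rfl | hn
  · simp only [Finset.univ_eq_empty, Finset.prod_empty, integral_const, probReal_univ, smul_eq_mul,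
      mul_one, momentConst]
    have := Real.add_one_le_exp (R + R ^ 2 / 2)
    simp
    nlinarith [sq_nonneg R]
  have hpt : ∀ ω, ∏ m, (‖Λ (h m)‖ + |W (h m) ω|) ≤ (∏ m, ‖Λ (h m)‖) *
      ∑ m, (n.factorial * Real.exp R / R ^ n) * Real.exp (R / ‖Λ (h m)‖ * |W (h m) ω|) := by
    intro ω
    have h1 : ∀ m, ‖Λ (h m)‖ + |W (h m) ω| = ‖Λ (h m)‖ * (1 + |W (h m) ω| / ‖Λ (h m)‖) := by
      intro m
      have := (ha m).ne'
      field_simp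
    simp only [h1, Finset.prod_mul_distrib]
    refine mul_le_mul_of_nonneg_left ?_ (Finset.prod_nonneg fun m _ => norm_nonneg _)
    refine (prod_le_sum_pow hn _ fun m => by positivity).trans (Finset.sum_le_sum fun m _ => ?_)
    have h2 := Real.pow_div_factorial_le_exp (R * (1 + |W (h m) ω| / ‖Λ (h m)‖)) (by positivity) n
    rw [div_le_iff₀ (by positivity), mul_pow, mul_add, Real.exp_add] at h2
    rw [div_mul_eq_mul_div, le_div_iff₀ (by positivity)]
    calc _ = R ^ n * (1 + |W (h m) ω| / ‖Λ (h m)‖) ^ n := by ring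
      _ ≤ _ := h2
      _ = _ := by rw [mul_one]; ring_nf
  refine (integral_mono (hW.integrable_prod_norm_add_abs h) (Integrable.const_mul
    (integrable_finsetSum _ fun m _ => (hW.integrable_exp_mul_abs _ (h m)).const_mul _) _)
    hpt).trans ?_
  rw [integral_const_mul, integral_finsetSum _ fun m _ =>
    (hW.integrable_exp_mul_abs _ (h m)).const_mul _, mul_comm]
  refine mul_le_mul_of_nonneg_right ?_ (Finset.prod_nonneg fun m _ => norm_nonneg _)
  have h3 : ∀ m ∈ (Finset.univ : Finset (Fin n)), ∫ ω, (n.factorial * Real.exp R / R ^ n) *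
      Real.exp (R / ‖Λ (h m)‖ * |W (h m) ω|) ∂γ ≤
      n.factorial * (2 * Real.exp (R + R ^ 2 / 2)) / R ^ n := by
    intro m _
    rw [integral_const_mul]
    refine (mul_le_mul_of_nonneg_left (hW.integral_exp_mul_abs_le _ (h m))
      (by positivity)).trans_eq ?_
    have : ‖Λ (h m)‖ ^ 2 * (R / ‖Λ (h m)‖) ^ 2 / 2 = R ^ 2 / 2 := by
      have := (ha m).ne'
      field_simp
    rw [this, Real.exp_add]
    ring
  refine (Finset.sum_le_card_nsmul _ _ _ h3).trans ?_
  rw [Finset.card_univ, Fintype.card_fin, nsmul_eq_mul, momentConst]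
  -- There are `n` terms; the factor `n + 1` in the constant keeps it positive at `n = 0`.
  exact mul_le_mul_of_nonneg_right (by linarith) (by positivity)

end IsIsonormal
end Isonormal

/-! ### Power series expansion and smoothness of the Wick transform. -/

section Isonormal

variable {X : Type*} [NormedAddCommGroup X] [InnerProductSpace ℝ X]
  {Ω : Type*} [MeasurableSpace Ω] {γ : Measure Ω} {Λ : X →L[ℝ] X} {W : X → Ω → ℝ}

namespace IsIsonormal

theorem integrable_prod (hW : IsIsonormal γ Λ W) {n : ℕ} (h : Fin n → X) {ψ : Ω → ℝ}
    (hψ : AEStronglyMeasurable ψ γ) {M : ℝ} (hM : ∀ ω, |ψ ω| ≤ M) :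
    Integrable (fun ω => ψ ω * ∏ m, W (h m) ω) γ := by
  refine Integrable.bdd_mul (c := M) ?_ hψ (Eventually.of_forall hM)
  refine (hW.integrable_prod_norm_add_abs h).mono' ?_ (Eventually.of_forall fun ω => ?_)
  · have := fun i => hW.aemeasurable (h i)
    exact AEMeasurable.aestronglyMeasurable (by fun_prop)
  · rw [Real.norm_eq_abs, Finset.abs_prod]
    exact Finset.prod_le_prod (fun _ _ => abs_nonneg _) fun m _ =>
      le_add_of_nonneg_left (norm_nonneg _)

/-- The multilinear form `(h₁, …, hₙ) ↦ 𝔼[ψ W(h₁) ⋯ W(hₙ)]`. -/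
noncomputable def momentMultilinear (hW : IsIsonormal γ Λ W) (n : ℕ) {ψ : Ω → ℝ}
    (hψ : AEStronglyMeasurable ψ γ) {M : ℝ} (hM : ∀ ω, |ψ ω| ≤ M) :
    MultilinearMap ℝ (fun _ : Fin n => X) ℝ where
  toFun h := ∫ ω, ψ ω * ∏ m, W (h m) ω ∂γ
  map_update_add' h i x y := by
    have key : ∀ z ω, ∏ m, W (Function.update h i z m) ω =
        W z ω * ∏ m ∈ Finset.univ \ {i}, W (h m) ω := fun z ω => by
      rw [← Finset.prod_update_of_mem (Finset.mem_univ i)]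
      refine Finset.prod_congr rfl fun m _ => ?_
      exact Function.apply_update (fun _ v => W v ω) h i z m
    rw [← integral_add (hW.integrable_prod _ hψ hM) (hW.integrable_prod _ hψ hM)]
    refine integral_congr_ae ?_
    filter_upwards [hW.add x y] with ω hω
    simp only [key, hω]
    ring
  map_update_smul' h i c x := by
    have key : ∀ z ω, ∏ m, W (Function.update h i z m) ω =
        W z ω * ∏ m ∈ Finset.univ \ {i}, W (h m) ω := fun z ω => by
      rw [← Finset.prod_update_of_mem (Finset.mem_univ i)]
      refine Finset.prod_congr rfl fun m _ => ?_
      exact Function.apply_update (fun _ v => W v ω) h i z m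
    rw [smul_eq_mul, ← integral_const_mul]
    refine integral_congr_ae ?_
    filter_upwards [hW.smul c x] with ω hω
    simp only [key, hω]
    ring

theorem norm_momentMultilinear_le (hW : IsIsonormal γ Λ W) (n : ℕ) {ψ : Ω → ℝ}
    (hψ : AEStronglyMeasurable ψ γ) {M : ℝ} (hM0 : 0 ≤ M) (hM : ∀ ω, |ψ ω| ≤ M) {R : ℝ} (hR : 0 < R)
    (h : Fin n → X) :
    ‖hW.momentMultilinear n hψ hM h‖ ≤ M * momentConst n R * ‖Λ‖ ^ n * ∏ m, ‖h m‖ := by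
  have h1 : ‖∫ ω, ψ ω * ∏ m, W (h m) ω ∂γ‖ ≤
      ∫ ω, M * ∏ m, (‖Λ (h m)‖ + |W (h m) ω|) ∂γ := by
    refine norm_integral_le_of_norm_le ((hW.integrable_prod_norm_add_abs h).const_mul M)
      (Eventually.of_forall fun ω => ?_)
    rw [norm_mul, Real.norm_eq_abs, Real.norm_eq_abs, Finset.abs_prod]
    refine mul_le_mul (hM ω) ?_ (Finset.prod_nonneg fun _ _ => abs_nonneg _) hM0
    exact Finset.prod_le_prod (fun _ _ => abs_nonneg _) fun m _ =>
      le_add_of_nonneg_left (norm_nonneg _)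
  refine h1.trans ?_
  rw [integral_const_mul, mul_assoc, mul_assoc]
  refine mul_le_mul_of_nonneg_left ?_ hM0
  refine (hW.integral_prod_norm_add_abs_le h hR).trans
    (mul_le_mul_of_nonneg_left ?_ (by unfold momentConst; positivity))
  calc ∏ m, ‖Λ (h m)‖ ≤ ∏ m, (‖Λ‖ * ‖h m‖) :=
        Finset.prod_le_prod (fun _ _ => norm_nonneg _) fun m _ => Λ.le_opNorm _
    _ = _ := by rw [Finset.prod_mul_distrib, Finset.prod_const, Finset.card_univ, Fintype.card_fin]

/-- The power series of `x ↦ 𝔼[ψ exp (W x)]`. -/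
noncomputable def momentSeries (hW : IsIsonormal γ Λ W) {ψ : Ω → ℝ}
    (hψ : AEStronglyMeasurable ψ γ) {M : ℝ} (hM0 : 0 ≤ M) (hM : ∀ ω, |ψ ω| ≤ M) :
    FormalMultilinearSeries ℝ X ℝ := fun n =>
  (n.factorial : ℝ)⁻¹ • (hW.momentMultilinear n hψ hM).mkContinuous _
    (hW.norm_momentMultilinear_le n hψ hM0 hM one_pos)

theorem radius_momentSeries (hW : IsIsonormal γ Λ W) {ψ : Ω → ℝ}
    (hψ : AEStronglyMeasurable ψ γ) {M : ℝ} (hM0 : 0 ≤ M) (hM : ∀ ω, |ψ ω| ≤ M) :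
    (hW.momentSeries hψ hM0 hM).radius = ⊤ := by
  refine ENNReal.eq_top_of_forall_nnreal_le fun r => ?_
  -- Chosen so that `‖Λ‖ r / R ≤ 1/2`, whose powers beat the factor `n + 1`; the `+ 1` keeps `R`
  -- positive.
  set R : ℝ := 2 * (‖Λ‖ * r + 1) with hRdef
  have hR : 0 < R := by positivity
  refine FormalMultilinearSeries.le_radius_of_bound _
    (M * (2 * (2 * Real.exp (R + R ^ 2 / 2)))) fun n => ?_
  have h1 : ‖hW.momentSeries hψ hM0 hM n‖ ≤
      (n.factorial : ℝ)⁻¹ * (M * momentConst n R * ‖Λ‖ ^ n) := by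
    rw [momentSeries, norm_smul, Real.norm_of_nonneg (by positivity)]
    refine mul_le_mul_of_nonneg_left ?_ (by positivity)
    refine ContinuousMultilinearMap.opNorm_le_bound (by unfold momentConst; positivity) fun h => ?_
    exact hW.norm_momentMultilinear_le n hψ hM0 hM hR h
  have h2 : (n + 1 : ℝ) * (‖Λ‖ * r / R) ^ n ≤ 2 := by
    have h3 : ‖Λ‖ * r / R ≤ 1 / 2 := by
      rw [div_le_iff₀ hR, hRdef]; linarith
    have h4 : (n + 1 : ℝ) ≤ 2 * 2 ^ n := by
      have : n + 1 ≤ 2 ^ (n + 1) := Nat.lt_two_pow_self.le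
      rw [pow_succ'] at this
      exact_mod_cast this
    calc (n + 1 : ℝ) * (‖Λ‖ * r / R) ^ n ≤ (2 * 2 ^ n) * (1 / 2) ^ n := by gcongr
      _ = 2 := by rw [mul_assoc, ← mul_pow]; norm_num
  calc ‖hW.momentSeries hψ hM0 hM n‖ * r ^ n
      ≤ (n.factorial : ℝ)⁻¹ * (M * momentConst n R * ‖Λ‖ ^ n) * r ^ n := by gcongr
    _ = M * (((n + 1 : ℝ) * (‖Λ‖ * r / R) ^ n) * (2 * Real.exp (R + R ^ 2 / 2))) := by
        rw [momentConst, div_pow, mul_pow ‖Λ‖]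
        field_simp
    _ ≤ _ := by gcongr

/-- The exponential series is integrated term by term, its partial sums being dominated by the
integrable `M exp |W y|`. -/
theorem hasFPowerSeriesOnBall_integral_exp (hW : IsIsonormal γ Λ W) {ψ : Ω → ℝ}
    (hψ : AEStronglyMeasurable ψ γ) {M : ℝ} (hM0 : 0 ≤ M) (hM : ∀ ω, |ψ ω| ≤ M) :
    HasFPowerSeriesOnBall (fun x => ∫ ω, ψ ω * Real.exp (W x ω) ∂γ)
      (hW.momentSeries hψ hM0 hM) 0 ⊤ where
  r_le := (hW.radius_momentSeries hψ hM0 hM).ge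
  r_pos := ENNReal.coe_lt_top
  hasSum {y} _ := by
    rw [zero_add]
    have hsum : ∀ z : ℝ, HasSum (fun n : ℕ => z ^ n / n.factorial) (Real.exp z) := fun z => by
      rw [Real.exp_eq_exp_ℝ]
      exact NormedSpace.expSeries_div_hasSum_exp z
    have h := hasSum_integral_of_dominated_convergence (μ := γ)
      (F := fun (n : ℕ) ω => ψ ω * (W y ω ^ n / n.factorial))
      (f := fun ω => ψ ω * Real.exp (W y ω))
      (fun n ω => M * (|W y ω| ^ n / n.factorial))
      (fun n => hψ.mul (((hW.aemeasurable y).pow_const n).div_const _).aestronglyMeasurable)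
      (fun n => Eventually.of_forall fun ω => by
        rw [norm_mul, norm_div, norm_pow, Real.norm_eq_abs, Real.norm_eq_abs, Real.norm_natCast]
        exact mul_le_mul_of_nonneg_right (hM ω) (by positivity))
      (Eventually.of_forall fun ω => ((hsum _).mul_left M).summable)
      (by
        simp only [((hsum _).mul_left M).tsum_eq]
        simpa using (hW.integrable_exp_mul_abs 1 y).const_mul M)
      (Eventually.of_forall fun ω => (hsum _).mul_left _)
    convert h using 2 with n
    simp only [momentSeries, momentMultilinear, smul_apply,
      MultilinearMap.coe_mkContinuous, MultilinearMap.coe_mk, Finset.prod_const, Finset.card_univ,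
      Fintype.card_fin, smul_eq_mul]
    rw [← integral_const_mul]
    refine integral_congr_ae (Eventually.of_forall fun ω => ?_)
    simp only []
    ring

/-- The function `x ↦ 𝔼[ψ exp (W x - ‖Λ x‖² / 2)]`. -/
noncomputable def wickTransform (γ : Measure Ω) (Λ : X →L[ℝ] X) (W : X → Ω → ℝ) (ψ : Ω → ℝ)
    (x : X) : ℝ :=
  ∫ ω, ψ ω * Real.exp (W x ω - ‖Λ x‖ ^ 2 / 2) ∂γ

/-- The deterministic factor `exp (-‖Λ x‖² / 2)` comes out of the integral; the remaining one is an
entire power series. -/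
theorem contDiff_wickTransform (hW : IsIsonormal γ Λ W) {ψ : Ω → ℝ}
    (hψ : AEStronglyMeasurable ψ γ) {M : ℝ} (hM : ∀ ω, |ψ ω| ≤ M) {n : WithTop ℕ∞} :
    ContDiff ℝ n (wickTransform γ Λ W ψ) := by
  have := hW.isProbabilityMeasure
  have hM0 : 0 ≤ M := (abs_nonneg _).trans (hM (nonempty_of_isProbabilityMeasure γ).some)
  have h1 : ContDiff ℝ n fun x => ∫ ω, ψ ω * Real.exp (W x ω) ∂γ := by
    have := (hW.hasFPowerSeriesOnBall_integral_exp hψ hM0 hM).analyticOnNhd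
    rw [Metric.eball_top] at this
    exact this.contDiff
  have h2 : wickTransform γ Λ W ψ =
      fun x => Real.exp (-(‖Λ x‖ ^ 2 / 2)) * ∫ ω, ψ ω * Real.exp (W x ω) ∂γ := by
    funext x
    rw [wickTransform, ← integral_const_mul]
    refine integral_congr_ae (Eventually.of_forall fun ω => ?_)
    simp only [sub_eq_add_neg, Real.exp_add]
    ring
  rw [h2]
  exact (Real.contDiff_exp.comp (((contDiff_norm_sq ℝ).comp Λ.contDiff).div_const 2).neg).mul h1

theorem integrable_wickBound (hW : IsIsonormal γ Λ W) (x k : X) {n : ℕ} (h : Fin n → X) (K : ℝ) :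
    Integrable (fun ω => K * Real.exp (∑ m, |W (h m) ω| + (|W x ω| + |W k ω|))) γ := by
  have := (hW.integrable_exp_sum_abs Finset.univ
    (Fin.cons x (Fin.cons k h : Fin (n + 1) → X) : Fin (n + 2) → X)).const_mul K
  simp only [Fin.sum_univ_succ, Fin.cons_zero, Fin.cons_succ] at this
  refine this.congr (Eventually.of_forall fun ω => ?_)
  simp only []
  congr 2
  ring

end IsIsonormal
end Isonormal

/-! ### Derivatives of the Wick transform as Hermite integrals. -/

section Isonormal

variable {X : Type*} [NormedAddCommGroup X] [InnerProductSpace ℝ X] [CompleteSpace X]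
  {Ω : Type*} {Λ : X →L[ℝ] X} {W : X → Ω → ℝ}

namespace IsIsonormal

theorem norm_hermiteForm_mul_exp_le {n : ℕ} (a : Fin n → X) (w : Fin n → ℝ) {ρ y : ℝ}
    (p : Fin n → ℝ) (hw : ∀ m, |w m| ≤ |p m| + ρ * ‖a m‖) (M : ℝ) {q : ℝ} (hq : |q| ≤ M) :
    ‖q * (hermiteForm a w * Real.exp y)‖ ≤
      M * hermiteCount n * Real.exp (∑ m, (1 + ρ) * ‖a m‖) * Real.exp (∑ m, |p m| + y) := by
  have hM : 0 ≤ M := (abs_nonneg _).trans hq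
  rw [norm_mul, norm_mul, Real.norm_of_nonneg (Real.exp_pos _).le, Real.exp_add]
  have h1 : |hermiteForm a w| ≤ hermiteCount n *
      (Real.exp (∑ m, (1 + ρ) * ‖a m‖) * Real.exp (∑ m, |p m|)) := by
    refine (abs_hermiteForm_le a w).trans (mul_le_mul_of_nonneg_left ?_ (Nat.cast_nonneg _))
    rw [← Real.exp_add, ← Finset.sum_add_distrib, Real.exp_sum]
    refine Finset.prod_le_prod (fun m _ => by positivity) fun m _ => ?_
    have := Real.add_one_le_exp ((1 + ρ) * ‖a m‖ + |p m|)
    linarith [hw m]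
  calc ‖q‖ * (‖hermiteForm a w‖ * Real.exp y)
      ≤ M * (hermiteCount n * (Real.exp (∑ m, (1 + ρ) * ‖a m‖) * Real.exp (∑ m, |p m|)) *
        Real.exp y) := by
        refine mul_le_mul hq (mul_le_mul_of_nonneg_right h1 (Real.exp_pos _).le) (by positivity) hM
    _ = _ := by ring

/-- The integrand of the derivatives of `wickTransform` at `x + e k`, up to a null set. -/
noncomputable def wickIntegrand (Λ : X →L[ℝ] X) (W : X → Ω → ℝ) (ψ : Ω → ℝ) (x k : X) {n : ℕ}
    (h : Fin n → X) (e : ℝ) (ω : Ω) : ℝ :=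
  ψ ω * (hermiteForm (fun m => Λ (h m)) (fun m => W (h m) ω - inner ℝ (Λ (x + e • k)) (Λ (h m))) *
    Real.exp (W x ω + e * W k ω - ‖Λ (x + e • k)‖ ^ 2 / 2))

theorem norm_wickIntegrand_le {ψ : Ω → ℝ} {M : ℝ} (hM : ∀ ω, |ψ ω| ≤ M) (x k : X) {n : ℕ}
    (h : Fin n → X) {e : ℝ} (he : |e| ≤ 1) (ω : Ω) :
    ‖wickIntegrand Λ W ψ x k h e ω‖ ≤ M * hermiteCount n *
      Real.exp (∑ m, (1 + (‖Λ x‖ + ‖Λ k‖)) * ‖Λ (h m)‖) *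
        Real.exp (∑ m, |W (h m) ω| + (|W x ω| + |W k ω|)) := by
  have hM0 : 0 ≤ M := (abs_nonneg _).trans (hM ω)
  have hx : ‖Λ (x + e • k)‖ ≤ ‖Λ x‖ + ‖Λ k‖ := by
    rw [map_add, map_smul]
    refine (norm_add_le _ _).trans (add_le_add_right ?_ _)
    rw [norm_smul]
    exact mul_le_of_le_one_left (norm_nonneg _) he
  refine (norm_hermiteForm_mul_exp_le (ρ := ‖Λ x‖ + ‖Λ k‖) _ _ (fun m => W (h m) ω) (fun m => ?_) M
    (hM ω)).trans ?_
  · refine (abs_sub _ _).trans (add_le_add_right ?_ _)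
    exact (abs_real_inner_le_norm _ _).trans (mul_le_mul_of_nonneg_right hx (norm_nonneg _))
  · refine mul_le_mul_of_nonneg_left (Real.exp_le_exp.2 (add_le_add_right ?_ _)) (by positivity)
    have h1 : e * W k ω ≤ |W k ω| := by
      refine (le_abs_self _).trans ?_
      rw [abs_mul]
      exact mul_le_of_le_one_left (abs_nonneg _) he
    have h2 : 0 ≤ ‖Λ (x + e • k)‖ ^ 2 / 2 := by positivity
    linarith [le_abs_self (W x ω)]

/-- With `v = W k - ⟨Λ (x + e k), Λ k⟩`, the exponential contributes `v` times the form, which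
cancels the term `-v * hermiteForm` of the recurrence and leaves exactly the form of order `n + 1`.
-/
theorem hasDerivAt_wickIntegrand (ψ : Ω → ℝ) (x k : X) {n : ℕ} (h : Fin n → X) (e : ℝ) (ω : Ω) :
    HasDerivAt (fun e => wickIntegrand Λ W ψ x k h e ω)
      (wickIntegrand Λ W ψ x k (Fin.cons k h : Fin (n + 1) → X) e ω) e := by
  have hL : HasDerivAt (fun e : ℝ => Λ (x + e • k)) (Λ k) e := by
    have : HasDerivAt (fun e : ℝ => x + e • k) k e := by
      simpa using ((hasDerivAt_id e).smul_const k).const_add x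
    exact Λ.hasFDerivAt.comp_hasDerivAt e this
  have hw : ∀ m, HasDerivAt (fun e : ℝ => W (h m) ω - inner ℝ (Λ (x + e • k)) (Λ (h m)))
      (-inner ℝ (Λ k) (Λ (h m))) e := fun m => by
    have := (hL.inner ℝ (hasDerivAt_const e (Λ (h m)))).const_sub (W (h m) ω)
    simpa using this
  have hE : HasDerivAt (fun e : ℝ => Real.exp (W x ω + e * W k ω - ‖Λ (x + e • k)‖ ^ 2 / 2))
      (Real.exp (W x ω + e * W k ω - ‖Λ (x + e • k)‖ ^ 2 / 2) *
        (W k ω - inner ℝ (Λ (x + e • k)) (Λ k))) e := by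
    have h1 := hL.norm_sq.div_const 2
    have h2 := ((hasDerivAt_id e).mul_const (W k ω)).const_add (W x ω)
    refine (h2.sub h1).exp.congr_deriv ?_
    simp only [Pi.sub_apply, id]
    ring
  have hH := hasDerivAt_hermiteForm (Λ k) (fun m => Λ (h m))
    (W k ω - inner ℝ (Λ (x + e • k)) (Λ k)) hw
  have h3 := (hH.mul hE).const_mul (ψ ω)
  refine h3.congr_deriv ?_
  have e1 : (fun m => Λ ((Fin.cons k h : Fin (n + 1) → X) m)) =
      (Fin.cons (Λ k) (fun m => Λ (h m)) : Fin (n + 1) → X) := by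
    funext m
    refine Fin.cases ?_ (fun m => ?_) m <;> simp
  have e2 : (fun m => W ((Fin.cons k h : Fin (n + 1) → X) m) ω -
      inner ℝ (Λ (x + e • k)) (Λ ((Fin.cons k h : Fin (n + 1) → X) m))) =
      (Fin.cons (W k ω - inner ℝ (Λ (x + e • k)) (Λ k))
        (fun m => W (h m) ω - inner ℝ (Λ (x + e • k)) (Λ (h m))) : Fin (n + 1) → ℝ) := by
    funext m
    refine Fin.cases ?_ (fun m => ?_) m <;> simp
  unfold wickIntegrand
  rw [e1, e2]
  ring

variable [MeasurableSpace Ω] {γ : Measure Ω}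

theorem aestronglyMeasurable_hermiteForm (hW : IsIsonormal γ Λ W) {n : ℕ} (a : Fin n → X)
    (h : Fin n → X) (c : Fin n → ℝ) :
    AEStronglyMeasurable (fun ω => hermiteForm a fun m => W (h m) ω - c m) γ := by
  have := fun i => hW.aemeasurable (h i)
  refine ((continuous_hermiteForm a).measurable.comp_aemeasurable
    (aemeasurable_pi_lambda _ fun m => ?_)).aestronglyMeasurable
  fun_prop

theorem aestronglyMeasurable_wickIntegrand (hW : IsIsonormal γ Λ W) {ψ : Ω → ℝ}
    (hψ : AEStronglyMeasurable ψ γ) (x k : X) {n : ℕ} (h : Fin n → X) (e : ℝ) :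
    AEStronglyMeasurable (wickIntegrand Λ W ψ x k h e) γ := by
  refine hψ.mul ((hW.aestronglyMeasurable_hermiteForm _ h _).mul ?_)
  have h1 := hW.aemeasurable x
  have h2 := hW.aemeasurable k
  exact AEMeasurable.aestronglyMeasurable (by fun_prop)

theorem integrable_wickIntegrand (hW : IsIsonormal γ Λ W) {ψ : Ω → ℝ}
    (hψ : AEStronglyMeasurable ψ γ) {M : ℝ} (hM : ∀ ω, |ψ ω| ≤ M) (x k : X) {n : ℕ}
    (h : Fin n → X) : Integrable (wickIntegrand Λ W ψ x k h 0) γ :=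
  (hW.integrable_wickBound x k h _).mono' (hW.aestronglyMeasurable_wickIntegrand hψ x k h 0)
    (Eventually.of_forall fun ω => norm_wickIntegrand_le hM x k h (by simp) ω)

theorem hasDerivAt_integral_wickIntegrand (hW : IsIsonormal γ Λ W) {ψ : Ω → ℝ}
    (hψ : AEStronglyMeasurable ψ γ) {M : ℝ} (hM : ∀ ω, |ψ ω| ≤ M) (x k : X) {n : ℕ}
    (h : Fin n → X) :
    HasDerivAt (fun e => ∫ ω, wickIntegrand Λ W ψ x k h e ω ∂γ)
      (∫ ω, wickIntegrand Λ W ψ x k (Fin.cons k h : Fin (n + 1) → X) 0 ω ∂γ) 0 := by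
  refine (hasDerivAt_integral_of_dominated_loc_of_deriv_le (Metric.ball_mem_nhds 0 one_pos)
    (Eventually.of_forall fun e => hW.aestronglyMeasurable_wickIntegrand hψ x k h e)
    (hW.integrable_wickIntegrand hψ hM x k h)
    (hW.aestronglyMeasurable_wickIntegrand hψ x k _ 0)
    (Eventually.of_forall fun ω e he => norm_wickIntegrand_le hM x k _ ?_ ω)
    (hW.integrable_wickBound x k _ _)
    (Eventually.of_forall fun ω e _ => hasDerivAt_wickIntegrand ψ x k h e ω)).2
  rw [mem_ball_zero_iff] at he
  exact he.le

/-- All derivatives of `wickTransform`, by Hermite forms. -/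
theorem iteratedFDeriv_wickTransform (hW : IsIsonormal γ Λ W) {ψ : Ω → ℝ}
    (hψ : AEStronglyMeasurable ψ γ) {M : ℝ} (hM : ∀ ω, |ψ ω| ≤ M) (n : ℕ) (x : X) (h : Fin n → X) :
    iteratedFDeriv ℝ n (wickTransform γ Λ W ψ) x h = ∫ ω, ψ ω *
      (hermiteForm (fun m => Λ (h m)) (fun m => W (h m) ω - inner ℝ (Λ x) (Λ (h m))) *
        Real.exp (W x ω - ‖Λ x‖ ^ 2 / 2)) ∂γ := by
  induction n generalizing x with
  | zero => simp [wickTransform, hermiteForm_fin_zero]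
  | succ n ih =>
    set k := h 0
    set a := Fin.tail h
    have hh : (Fin.cons k a : Fin (n + 1) → X) = h := Fin.cons_self_tail h
    -- Linearity of `W` holds only off a null set depending on `e`. `wickIntegrand` has `W x + e W
    -- k` built in, so it is differentiable in `e` for every `ω` while having the same integral.
    have h1 : ∀ e : ℝ, iteratedFDeriv ℝ n (wickTransform γ Λ W ψ) (x + e • k) a =
        ∫ ω, wickIntegrand Λ W ψ x k a e ω ∂γ := fun e => by
      rw [ih]
      refine integral_congr_ae ?_
      filter_upwards [hW.add x (e • k), hW.smul e k] with ω h2 h3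
      rw [wickIntegrand, h2, h3]
    have h2 := hW.hasDerivAt_integral_wickIntegrand hψ hM x k a
    simp only [← h1] at h2
    -- Smoothness is already known, so the next Fréchet derivative exists and is identified by its
    -- value along a line.
    have h3 : HasDerivAt (fun e : ℝ => iteratedFDeriv ℝ n (wickTransform γ Λ W ψ) (x + e • k) a)
        (iteratedFDeriv ℝ (n + 1) (wickTransform γ Λ W ψ) x h) 0 := by
      have hd : DifferentiableAt ℝ (iteratedFDeriv ℝ n (wickTransform γ Λ W ψ)) x :=
        ((hW.contDiff_wickTransform hψ hM (n := (n + 1 : ℕ))).differentiable_iteratedFDeriv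
          (by exact_mod_cast Nat.lt_succ_self n)) x
      have hline : HasDerivAt (fun e : ℝ => x + e • k) k 0 := by
        simpa using (((hasDerivAt_id (0 : ℝ)).smul_const k).const_add x)
      have hd' : HasFDerivAt (iteratedFDeriv ℝ n (wickTransform γ Λ W ψ))
          (fderiv ℝ (iteratedFDeriv ℝ n (wickTransform γ Λ W ψ)) x) (x + (0 : ℝ) • k) := by
        simpa using hd.hasFDerivAt
      have h4 := hd'.comp_hasDerivAt 0 hline
      have h5 := (ContinuousMultilinearMap.apply ℝ (fun _ : Fin n => X) ℝ
        a).hasFDerivAt.comp_hasDerivAt 0 h4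
      exact h5
    rw [h3.unique h2, hh]
    refine integral_congr_ae (Eventually.of_forall fun ω => ?_)
    simp [wickIntegrand]

theorem integrable_mul_hermiteForm (hW : IsIsonormal γ Λ W) {ψ : Ω → ℝ}
    (hψ : AEStronglyMeasurable ψ γ) {M : ℝ} (hM : ∀ ω, |ψ ω| ≤ M) {n : ℕ} (h : Fin n → X) :
    Integrable (fun ω => ψ ω * hermiteForm (fun m => Λ (h m)) (fun m => W (h m) ω)) γ := by
  refine Integrable.bdd_mul (c := M) ?_ hψ (Eventually.of_forall hM)
  refine ((hW.integrable_prod_norm_add_abs h).const_mul (hermiteCount n)).mono' ?_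
    (Eventually.of_forall fun ω => abs_hermiteForm_le _ _)
  simpa using hW.aestronglyMeasurable_hermiteForm (fun m => Λ (h m)) h 0

theorem iteratedFDeriv_wickTransform_zero (hW : IsIsonormal γ Λ W) {ψ : Ω → ℝ}
    (hψ : AEStronglyMeasurable ψ γ) {M : ℝ} (hM : ∀ ω, |ψ ω| ≤ M) {n : ℕ} (h : Fin n → X) :
    iteratedFDeriv ℝ n (wickTransform γ Λ W ψ) 0 h =
      ∫ ω, ψ ω * hermiteForm (fun m => Λ (h m)) (fun m => W (h m) ω) ∂γ := by
  rw [hW.iteratedFDeriv_wickTransform hψ hM]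
  refine integral_congr_ae ?_
  filter_upwards [hW.ae_eq_zero (map_zero Λ)] with ω hω
  simp [hω]

theorem norm_iteratedFDeriv_wickTransform_zero_le (hW : IsIsonormal γ Λ W) {ψ : Ω → ℝ}
    (hψ : AEStronglyMeasurable ψ γ) {M : ℝ} (hM : ∀ ω, |ψ ω| ≤ M) (n : ℕ) :
    ‖iteratedFDeriv ℝ n (wickTransform γ Λ W ψ) 0‖ ≤
      hermiteCount n * momentConst n 1 * M * ‖Λ‖ ^ n := by
  have := hW.isProbabilityMeasure
  have hM0 : 0 ≤ M := (abs_nonneg _).trans (hM (nonempty_of_isProbabilityMeasure γ).some)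
  have hK : 0 ≤ momentConst n 1 := by unfold momentConst; positivity
  refine ContinuousMultilinearMap.opNorm_le_bound (by positivity) fun h => ?_
  rw [hW.iteratedFDeriv_wickTransform_zero hψ hM]
  have h1 : ‖∫ ω, ψ ω * hermiteForm (fun m => Λ (h m)) (fun m => W (h m) ω) ∂γ‖ ≤
      ∫ ω, M * hermiteCount n * ∏ m, (‖Λ (h m)‖ + |W (h m) ω|) ∂γ := by
    refine norm_integral_le_of_norm_le ((hW.integrable_prod_norm_add_abs h).const_mul _)
      (Eventually.of_forall fun ω => ?_)
    rw [norm_mul, mul_assoc]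
    exact mul_le_mul (hM ω) (abs_hermiteForm_le _ _) (norm_nonneg _) hM0
  refine h1.trans ?_
  rw [integral_const_mul]
  have h2 : ∏ m, ‖Λ (h m)‖ ≤ ‖Λ‖ ^ n * ∏ m, ‖h m‖ := by
    calc ∏ m, ‖Λ (h m)‖ ≤ ∏ m, (‖Λ‖ * ‖h m‖) :=
          Finset.prod_le_prod (fun _ _ => norm_nonneg _) fun m _ => Λ.le_opNorm _
      _ = _ := by
        rw [Finset.prod_mul_distrib, Finset.prod_const, Finset.card_univ, Fintype.card_fin]
  calc M * hermiteCount n * ∫ ω, ∏ m, (‖Λ (h m)‖ + |W (h m) ω|) ∂γ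
      ≤ M * hermiteCount n * (momentConst n 1 * (‖Λ‖ ^ n * ∏ m, ‖h m‖)) :=
        mul_le_mul_of_nonneg_left ((hW.integral_prod_norm_add_abs_le h one_pos).trans
          (mul_le_mul_of_nonneg_left h2 hK)) (by positivity)
    _ = _ := by ring

end IsIsonormal
end Isonormal

/-! ### White noise and the Cameron–Martin formula. -/

section WhiteNoise

variable {X : Type*} [NormedAddCommGroup X] [InnerProductSpace ℝ X] [CompleteSpace X]
  {Q : X →L[ℝ] X}

theorem inner_eq_inner_sqrtOp (hQ : Q.IsPositive) (x y : X) :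
    inner ℝ (Q x) y = inner ℝ (sqrtOp Q x) (sqrtOp Q y) := by
  obtain ⟨hS, hSS⟩ := sqrtOp_spec hQ
  conv_lhs => rw [← hSS]
  rw [ContinuousLinearMap.comp_apply, hS.inner_left_eq_inner_right]

variable [TopologicalSpace.SeparableSpace X] [MeasurableSpace X] [BorelSpace X]

theorem isGaussian_gaussian (hQ : IsPosTraceClass Q) (m : X) : IsGaussian (gaussian m Q) :=
  (isGaussianWith_gaussian hQ m).1

theorem integral_cexp_inner (hQ : IsPosTraceClass Q) (b : X) :
    ∫ y, Complex.exp ((inner ℝ b y : ℝ) * Complex.I) ∂(gaussian 0 Q) =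
      Complex.exp (-((‖sqrtOp Q b‖ ^ 2 : ℝ) / 2)) := by
  have h := charFun_isGaussianWith (isGaussianWith_gaussian hQ 0) b
  rw [charFun_apply] at h
  rw [inner_eq_inner_sqrtOp hQ.1, real_inner_self_eq_norm_sq, inner_zero_right,
    Complex.ofReal_zero, zero_mul, zero_sub] at h
  simpa only [real_inner_comm b] using h

theorem memLp_inner_gaussian (hQ : IsPosTraceClass Q) (b : X) :
    MemLp (fun y => inner ℝ b y) 2 (gaussian 0 Q) := by
  have : SecondCountableTopology X := UniformSpace.secondCountable_of_separable X
  have := isGaussian_gaussian hQ 0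
  exact IsGaussian.memLp_dual _ (innerSL ℝ b) 2 (by simp)

/-- The isometry behind white noise: the variance of `⟨b, ·⟩` is `⟨Q b, b⟩ = ‖Q^{1/2} b‖²`. It turns
Cauchy sequences in the range of `Q^{1/2}` into Cauchy sequences in `L²`. -/
theorem norm_toLp_inner (hQ : IsPosTraceClass Q) (b : X) :
    ‖(memLp_inner_gaussian hQ b).toLp‖ = ‖sqrtOp Q b‖ := by
  have : SecondCountableTopology X := UniformSpace.secondCountable_of_separable X
  have := isGaussian_gaussian hQ 0
  have h := (isGaussianWith_gaussian hQ 0)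
  refine (sq_eq_sq₀ (norm_nonneg _) (norm_nonneg _)).1 ?_
  rw [← real_inner_self_eq_norm_sq, ← real_inner_self_eq_norm_sq, ← inner_eq_inner_sqrtOp hQ.1,
    ← h.2.2, covarianceBilin_apply IsGaussian.memLp_two_id, L2.inner_def]
  refine integral_congr_ae ?_
  filter_upwards [(memLp_inner_gaussian hQ b).coeFn_toLp] with y hy
  simp only [id]
  rw [hy, h.2.1, sub_zero]
  rfl

theorem exists_isWhiteNoise (hQ : IsPosTraceClass Q) {a : X}
    (ha : a ∈ closure (Set.range (sqrtOp Q))) : ∃ w, IsWhiteNoise Q a w := by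
  obtain ⟨u, hu, hlim⟩ := mem_closure_iff_seq_limit.1 ha
  choose b hb using hu
  have hlim' : Tendsto (fun k => sqrtOp Q (b k)) atTop (𝓝 a) := by simpa only [hb] using hlim
  have hdist : ∀ k l, dist (memLp_inner_gaussian hQ (b k)).toLp
      (memLp_inner_gaussian hQ (b l)).toLp =
      dist (sqrtOp Q (b k)) (sqrtOp Q (b l)) := fun k l => by
    rw [dist_eq_norm, dist_eq_norm, ← map_sub, ← norm_toLp_inner hQ, ← MemLp.toLp_sub]
    congr 1
    refine MemLp.toLp_congr _ _ (Eventually.of_forall fun y => ?_)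
    simp [inner_sub_left]
  have hc : CauchySeq fun k => (memLp_inner_gaussian hQ (b k)).toLp := by
    have := hlim'.cauchySeq
    rw [Metric.cauchySeq_iff] at this ⊢
    simpa only [hdist] using this
  obtain ⟨w, hw⟩ := cauchySeq_tendsto_of_complete hc
  refine ⟨w, Lp.memLp w, b, hlim', ?_⟩
  refine ((Lp.tendsto_Lp_iff_tendsto_eLpNorm' _ _).1 hw).congr fun k => eLpNorm_congr_ae ?_
  filter_upwards [(memLp_inner_gaussian hQ (b k)).coeFn_toLp] with y hy
  rw [Pi.sub_apply, hy]

theorem isWhiteNoise_whiteNoise (hQ : IsPosTraceClass Q) {a : X}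
    (ha : a ∈ closure (Set.range (sqrtOp Q))) : IsWhiteNoise Q a (whiteNoise Q a) := by
  have h := exists_isWhiteNoise hQ ha
  simpa only [whiteNoise, dif_pos h] using h.choose_spec

theorem isWhiteNoise_inner (hQ : IsPosTraceClass Q) (b : X) :
    IsWhiteNoise Q (sqrtOp Q b) fun y => inner ℝ b y :=
  ⟨memLp_inner_gaussian hQ b, fun _ => b, tendsto_const_nhds, by simp⟩

theorem IsWhiteNoise.smul_add (hQ : IsPosTraceClass Q) {a a' : X} {w w' : X → ℝ} (c : ℝ)
    (hw : IsWhiteNoise Q a w) (hw' : IsWhiteNoise Q a' w') :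
    IsWhiteNoise Q (c • a + a') fun y => c * w y + w' y := by
  obtain ⟨hm, b, hb, hl⟩ := hw
  obtain ⟨hm', b', hb', hl'⟩ := hw'
  refine ⟨(hm.const_mul c).add hm', fun k => c • b k + b' k, ?_, ?_⟩
  · simpa only [map_add, map_smul] using (hb.const_smul c).add hb'
  · have h1 := (ENNReal.Tendsto.const_mul hl (a := ‖c‖ₑ) (Or.inr enorm_ne_top)).add hl'
    rw [mul_zero, add_zero] at h1
    refine tendsto_of_tendsto_of_tendsto_of_le_of_le tendsto_const_nhds h1 (fun _ => bot_le)
      fun k => ?_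
    have h2 : (fun y => inner ℝ (c • b k + b' k) y - (c * w y + w' y)) =
        (c • fun y => inner ℝ (b k) y - w y) + fun y => inner ℝ (b' k) y - w' y := by
      funext y
      simp only [inner_add_left, inner_smul_left, Pi.add_apply, Pi.smul_apply, smul_eq_mul,
        conj_trivial]
      ring
    simp only [h2]
    refine (eLpNorm_add_le ?_ ?_ one_le_two).trans (add_le_add_left ?_ _)
    · exact (((memLp_inner_gaussian hQ (b k)).sub hm).const_smul c).aestronglyMeasurable
    · exact ((memLp_inner_gaussian hQ (b' k)).sub hm').aestronglyMeasurable
    · exact (eLpNorm_const_smul _ _ _ _).le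

theorem IsWhiteNoise.map_eq (hQ : IsPosTraceClass Q) {a : X} {w : X → ℝ}
    (hw : IsWhiteNoise Q a w) : (gaussian 0 Q).map w = gaussianReal 0 (‖a‖₊ ^ 2) := by
  have := isGaussian_gaussian hQ 0
  obtain ⟨hm, b, hb, hl⟩ := hw
  have hwm := hm.aestronglyMeasurable.aemeasurable
  have : IsProbabilityMeasure ((gaussian 0 Q).map w) := Measure.isProbabilityMeasure_map hwm
  refine Measure.ext_of_charFun (funext fun s => ?_)
  rw [charFun_apply_real, integral_map hwm (by fun_prop), charFun_gaussianReal]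
  have h1 : Tendsto (fun k => eLpNorm ((fun y => inner ℝ (s • b k) y) - fun y => s * w y) 2
      (gaussian 0 Q)) atTop (𝓝 0) := by
    have h2 := ENNReal.Tendsto.const_mul hl (a := ‖s‖ₑ) (Or.inr enorm_ne_top)
    rw [mul_zero] at h2
    refine h2.congr fun k => ?_
    rw [← eLpNorm_const_smul]
    congr 1
    funext y
    simp [inner_smul_left, mul_sub]
  have h3 := tendsto_integral_cexp_of_tendsto_eLpNorm
    (fun k => (memLp_inner_gaussian hQ (s • b k)).aestronglyMeasurable)
    (hm.const_mul s).aestronglyMeasurable h1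
  simp only [integral_cexp_inner hQ] at h3
  have h4 : Tendsto (fun k => Complex.exp (-((‖sqrtOp Q (s • b k)‖ ^ 2 : ℝ) / 2))) atTop
      (𝓝 (Complex.exp (-((‖s • a‖ ^ 2 : ℝ) / 2)))) := by
    have h5 : Tendsto (fun k => ‖sqrtOp Q (s • b k)‖ ^ 2) atTop (𝓝 (‖s • a‖ ^ 2)) := by
      simp only [map_smul]
      exact ((hb.const_smul s).norm).pow 2
    refine (Complex.continuous_exp.tendsto _).comp (Tendsto.neg (Tendsto.div_const ?_ 2))
    exact (Complex.continuous_ofReal.tendsto _).comp h5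
  rw [norm_smul, mul_pow, Real.norm_eq_abs, sq_abs] at h4
  have h6 := tendsto_nhds_unique h3 h4
  push_cast at h6 ⊢
  rw [h6]
  congr 1
  ring

/-- The difference of two versions is white noise for the vector `0`, whose law is a Dirac mass.
Thus the approximating sequence and the chosen version do not matter, and linearity in `a` holds
almost surely. -/
theorem IsWhiteNoise.ae_eq (hQ : IsPosTraceClass Q) {a : X} {w w' : X → ℝ}
    (hw : IsWhiteNoise Q a w) (hw' : IsWhiteNoise Q a w') : w =ᵐ[gaussian 0 Q] w' := by
  have h := hw.smul_add hQ (-1) hw'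
  have h1 := h.map_eq hQ
  simp only [neg_smul, one_smul, neg_add_cancel, nnnorm_zero, ne_eq, OfNat.ofNat_ne_zero,
    not_false_eq_true, zero_pow, gaussianReal_zero_var] at h1
  have h2 : ∀ᵐ z ∂((gaussian 0 Q).map fun y => -1 * w y + w' y), z = 0 := by
    rw [h1]; simp [ae_dirac_eq]
  filter_upwards [ae_of_ae_map h.1.aestronglyMeasurable.aemeasurable h2] with y hy
  linarith

theorem isIsonormal_whiteNoise (hQ : IsPosTraceClass Q) {Λ : X →L[ℝ] X}
    (hΛ : ∀ x, Λ x ∈ closure (Set.range (sqrtOp Q))) :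
    IsIsonormal (gaussian 0 Q) Λ fun x => whiteNoise Q (Λ x) where
  law x := (isWhiteNoise_whiteNoise hQ (hΛ x)).map_eq hQ
  add x y := by
    have h := (isWhiteNoise_whiteNoise hQ (hΛ x)).smul_add hQ 1 (isWhiteNoise_whiteNoise hQ (hΛ y))
    simp only [one_smul, one_mul, ← map_add] at h
    exact (isWhiteNoise_whiteNoise hQ (hΛ _)).ae_eq hQ h
  smul c x := by
    have h0 : IsWhiteNoise Q 0 fun _ : X => (0 : ℝ) := by
      simpa using isWhiteNoise_inner hQ 0
    have h := (isWhiteNoise_whiteNoise hQ (hΛ x)).smul_add hQ c h0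
    simp only [add_zero, ← map_smul] at h
    exact (isWhiteNoise_whiteNoise hQ (hΛ _)).ae_eq hQ h

theorem IsWhiteNoise.integrable_exp (hQ : IsPosTraceClass Q) {a : X} {w : X → ℝ}
    (hw : IsWhiteNoise Q a w) : Integrable (fun y => Real.exp (w y)) (gaussian 0 Q) := by
  have h := integrable_exp_mul_gaussianReal (μ := 0) (v := ‖a‖₊ ^ 2) 1
  rw [← hw.map_eq hQ] at h
  simpa [Function.comp_def] using h.comp_aemeasurable hw.1.aestronglyMeasurable.aemeasurable

theorem IsWhiteNoise.integral_exp (hQ : IsPosTraceClass Q) {a : X} {w : X → ℝ}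
    (hw : IsWhiteNoise Q a w) :
    ∫ y, Real.exp (w y) ∂(gaussian 0 Q) = Real.exp (‖a‖ ^ 2 / 2) := by
  have := mgf_gaussianReal (hw.map_eq hQ) 1
  simpa [mgf] using this

/-- The Cameron–Martin formula. -/
theorem IsWhiteNoise.map_add_eq_tilted (hQ : IsPosTraceClass Q) {a : X} {w : X → ℝ}
    (hw : IsWhiteNoise Q a w) :
    (gaussian 0 Q).map (· + sqrtOp Q a) = (gaussian 0 Q).tilted w := by
  have : SecondCountableTopology X := UniformSpace.secondCountable_of_separable X
  have := isGaussian_gaussian hQ 0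
  have : IsProbabilityMeasure ((gaussian 0 Q).map (· + sqrtOp Q a)) :=
    Measure.isProbabilityMeasure_map (by fun_prop)
  have : IsProbabilityMeasure ((gaussian 0 Q).tilted w) :=
    isProbabilityMeasure_tilted (hw.integrable_exp hQ)
  obtain ⟨hS, hSS⟩ := sqrtOp_spec hQ.1
  refine Measure.ext_of_charFun (funext fun z => ?_)
  -- Under the tilt, `s ⟨z, ·⟩ + w` is white noise for `s Q^{1/2} z + a`. Its exponential moment has
  -- the cross term `s ⟨Q^{1/2} z, a⟩`, which is the shift of the mean.
  have hmgf : mgf (fun y => inner ℝ z y) ((gaussian 0 Q).tilted w) =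
      mgf id (gaussianReal (inner ℝ (sqrtOp Q z) a) (‖sqrtOp Q z‖₊ ^ 2)) := by
    funext s
    rw [mgf_id_gaussianReal, mgf, integral_tilted, hw.integral_exp hQ]
    have h1 := ((isWhiteNoise_inner hQ z).smul_add hQ s hw).integral_exp hQ
    have h2 : ∀ y, (Real.exp (w y) / Real.exp (‖a‖ ^ 2 / 2)) • Real.exp (s * inner ℝ z y) =
        Real.exp (-(‖a‖ ^ 2 / 2)) * Real.exp (s * inner ℝ z y + w y) := fun y => by
      rw [smul_eq_mul, Real.exp_add, Real.exp_neg]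
      ring
    simp only [h2]
    rw [integral_const_mul, h1, ← Real.exp_add, norm_add_sq_real, norm_smul, inner_smul_left,
      mul_pow, Real.norm_eq_abs, sq_abs]
    congr 1
    simp only [conj_trivial, NNReal.coe_pow, coe_nnnorm]
    ring
  -- Analytic continuation from real exponents to `I` turns the moment generating function into the
  -- characteristic function.
  have h1 := eqOn_complexMGF_of_mgf hmgf (x := Complex.I) (by
    rw [integrableExpSet_eq_of_mgf hmgf, integrableExpSet_id_gaussianReal]
    simp)
  rw [complexMGF_id_gaussianReal, complexMGF] at h1
  rw [charFun_map_add_const, charFun_isGaussianWith (isGaussianWith_gaussian hQ 0),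
    inner_eq_inner_sqrtOp hQ.1, real_inner_self_eq_norm_sq, charFun_apply]
  simp only [real_inner_comm z]
  have h2 : ∀ y, ((inner ℝ z y : ℝ) : ℂ) * Complex.I = Complex.I * (inner ℝ z y : ℝ) := fun y =>
    mul_comm _ _
  simp only [h2]
  rw [h1, ← Complex.exp_add]
  congr 1
  rw [hS.inner_left_eq_inner_right]
  simp
  ring

end WhiteNoise

/-! ### Application to the transition operator. -/

section TransitionOperator

variable {X : Type*} [NormedAddCommGroup X] [InnerProductSpace ℝ X] [CompleteSpace X]
  {T : ℝ} {U : ℝ → ℝ → X →L[ℝ] X} {B : ℝ → X →L[ℝ] X} {f : ℝ → X} {s t : ℝ}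

theorem pseudoInv_spec {S : X →L[ℝ] X} {y : X} (h : y ∈ Set.range S) :
    pseudoInv S y ∈ (LinearMap.ker (S : X →ₗ[ℝ] X))ᗮ ∧ S (pseudoInv S y) = y := by
  have : CompleteSpace (LinearMap.ker (S : X →ₗ[ℝ] X)) := S.isClosed_ker.completeSpace_coe
  have hex : ∃ z : X, z ∈ (LinearMap.ker (S : X →ₗ[ℝ] X))ᗮ ∧ S z = y := by
    obtain ⟨z, hz⟩ := h
    obtain ⟨p, hp, q, hq, rfl⟩ :=
      (LinearMap.ker (S : X →ₗ[ℝ] X)).exists_add_mem_mem_orthogonal z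
    refine ⟨q, hq, ?_⟩
    have : S p = 0 := hp
    rw [← hz, map_add, this, zero_add]
  simpa only [pseudoInv, dif_pos hex] using hex.choose_spec

theorem sqrtOp_Lam (hR : RangeHyp T U B) (hs : 0 ≤ s) (hst : s < t) (ht : t ≤ T) (x : X) :
    sqrtOp (covOp U B t s) (Lam U B t s x) = U t s x := by
  rw [Lam, pseudoInvComp_apply _ _ (hR s t hs hst ht)]
  exact (pseudoInv_spec (hR s t hs hst ht ⟨x, rfl⟩)).2

/-- The pseudo-inverse takes values in `(ker S)ᗮ`, which for self-adjoint `S` is the closure of its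
range; so white noise is defined at every `Λ x`. -/
theorem Lam_mem_closure_range (hQ : (covOp U B t s).IsPositive) (hR : RangeHyp T U B) (hs : 0 ≤ s)
    (hst : s < t) (ht : t ≤ T) (x : X) :
    Lam U B t s x ∈ closure (Set.range (sqrtOp (covOp U B t s))) := by
  have h := (pseudoInv_spec (hR s t hs hst ht ⟨x, rfl⟩)).1
  rw [Lam, pseudoInvComp_apply _ _ (hR s t hs hst ht)]
  have h1 := (sqrtOp (covOp U B t s)).orthogonal_ker
  rw [(sqrtOp_spec hQ).1.isSelfAdjoint.adjoint_eq] at h1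
  change _ ∈ (sqrtOp (covOp U B t s)).kerᗮ at h
  rw [h1] at h
  rw [← SetLike.mem_coe, Submodule.topologicalClosure_coe] at h
  exact h

variable [TopologicalSpace.SeparableSpace X] [MeasurableSpace X] [BorelSpace X]

theorem isIsonormal_Lam (H : EvolutionHyp T U B f) (hR : RangeHyp T U B) (hs : 0 ≤ s) (hst : s < t)
    (ht : t ≤ T) : IsIsonormal (gaussian 0 (covOp U B t s)) (Lam U B t s)
      fun x => whiteNoise (covOp U B t s) (Lam U B t s x) :=
  have hQ := H.traceClass s t hs hst.le ht
  isIsonormal_whiteNoise hQ (Lam_mem_closure_range hQ.1 hR hs hst ht)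

/-- The transition operator as a Wick transform, from the Cameron–Martin formula. -/
theorem transOp_add_eq_wickTransform (H : EvolutionHyp T U B f) (hR : RangeHyp T U B) (hs : 0 ≤ s)
    (hst : s < t) (ht : t ≤ T) {φ : X → ℝ} (hφ : Measurable φ) (x v : X) :
    transOp U B f s t φ (x + v) = IsIsonormal.wickTransform (gaussian 0 (covOp U B t s))
      (Lam U B t s) (fun x => whiteNoise (covOp U B t s) (Lam U B t s x))
      (fun y => φ (y + meanVec U f t s x)) v := by
  have hQ := H.traceClass s t hs hst.le ht
  have hw := isWhiteNoise_whiteNoise hQ (Lam_mem_closure_range hQ.1 hR hs hst ht v)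
  -- Only `U v = Q^{1/2} Λ v` distinguishes the two means, and this is an admissible Cameron–Martin
  -- shift.
  have hm : ∀ y, y + meanVec U f t s (x + v) =
      (y + sqrtOp (covOp U B t s) (Lam U B t s v)) + meanVec U f t s x := fun y => by
    rw [sqrtOp_Lam hR hs hst ht, meanVec, meanVec, map_add]
    abel
  have hφ' : Measurable fun y => φ (y + meanVec U f t s x) := by fun_prop
  rw [transOp, gaussian_eq_map_add hQ, integral_map (by fun_prop) hφ.aestronglyMeasurable]
  simp only [hm]
  rw [← integral_map (φ := fun y => y + sqrtOp (covOp U B t s) (Lam U B t s v))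
    (f := fun y => φ (y + meanVec U f t s x)) (by fun_prop) hφ'.aestronglyMeasurable,
    hw.map_add_eq_tilted hQ, integral_tilted, hw.integral_exp hQ, IsIsonormal.wickTransform]
  refine integral_congr_ae (Eventually.of_forall fun y => ?_)
  simp only [smul_eq_mul, Real.exp_sub]
  ring

/-- Recentring at `x` puts the evaluation point at `0`, where the Wick exponential is almost surely
`1`; `x` survives only as a translation of `φ`, which leaves its bounds unchanged. -/
theorem iteratedFDeriv_transOp_eq (H : EvolutionHyp T U B f) (hR : RangeHyp T U B) (hs : 0 ≤ s)
    (hst : s < t) (ht : t ≤ T) {φ : X → ℝ} (hφ : Measurable φ) (n : ℕ) (x : X) :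
    iteratedFDeriv ℝ n (transOp U B f s t φ) x =
      iteratedFDeriv ℝ n (IsIsonormal.wickTransform (gaussian 0 (covOp U B t s))
        (Lam U B t s) (fun x => whiteNoise (covOp U B t s) (Lam U B t s x))
        (fun y => φ (y + meanVec U f t s x))) 0 := by
  have h := iteratedFDeriv_comp_add_left (𝕜 := ℝ) (f := transOp U B f s t φ) n x 0
  rw [add_zero] at h
  rw [← h]
  congr 1
  exact funext fun v => transOp_add_eq_wickTransform H hR hs hst ht hφ x v

theorem contDiff_transOp (H : EvolutionHyp T U B f) (hR : RangeHyp T U B) (hs : 0 ≤ s)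
    (hst : s < t) (ht : t ≤ T) {φ : X → ℝ} (hφ : Measurable φ) {M : ℝ} (hM : ∀ x, |φ x| ≤ M)
    {n : WithTop ℕ∞} : ContDiff ℝ n (transOp U B f s t φ) := by
  have h : transOp U B f s t φ = _ := funext fun v => (congrArg _ (zero_add v)).symm.trans
    (transOp_add_eq_wickTransform H hR hs hst ht hφ 0 v)
  rw [h]
  exact (isIsonormal_Lam H hR hs hst ht).contDiff_wickTransform
    (ψ := fun y => φ (y + meanVec U f t s 0))
    (Measurable.aestronglyMeasurable (by fun_prop)) (fun y => hM _)

theorem norm_iteratedFDeriv_transOp_le (H : EvolutionHyp T U B f) (hR : RangeHyp T U B)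
    (hs : 0 ≤ s) (hst : s < t) (ht : t ≤ T) {φ : X → ℝ} (hφ : Measurable φ) {M : ℝ}
    (hM : ∀ x, |φ x| ≤ M) (n : ℕ) (x : X) :
    ‖iteratedFDeriv ℝ n (transOp U B f s t φ) x‖ ≤
      hermiteCount n * IsIsonormal.momentConst n 1 * M * ‖Lam U B t s‖ ^ n := by
  rw [iteratedFDeriv_transOp_eq H hR hs hst ht hφ]
  exact (isIsonormal_Lam H hR hs hst ht).norm_iteratedFDeriv_wickTransform_zero_le
    (Measurable.aestronglyMeasurable (by fun_prop)) (fun y => hM _) n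

theorem iteratedFDeriv_transOp (H : EvolutionHyp T U B f) (hR : RangeHyp T U B)
    (hs : 0 ≤ s) (hst : s < t) (ht : t ≤ T) {φ : X → ℝ} (hφ : Measurable φ) {M : ℝ}
    (hM : ∀ x, |φ x| ≤ M) (n : ℕ) (x : X) (h : Fin n → X) :
    Integrable (fun y => φ (y + meanVec U f t s x) * In U B t s y h)
        (gaussian 0 (covOp U B t s)) ∧
      iteratedFDeriv ℝ n (transOp U B f s t φ) x h =
        ∫ y, φ (y + meanVec U f t s x) * In U B t s y h ∂(gaussian 0 (covOp U B t s)) := by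
  rw [iteratedFDeriv_transOp_eq H hR hs hst ht hφ]
  have hψ : AEStronglyMeasurable (fun y => φ (y + meanVec U f t s x))
    (gaussian 0 (covOp U B t s)) := Measurable.aestronglyMeasurable (by fun_prop)
  exact ⟨(isIsonormal_Lam H hR hs hst ht).integrable_mul_hermiteForm hψ (fun y => hM _) h,
    (isIsonormal_Lam H hR hs hst ht).iteratedFDeriv_wickTransform_zero hψ (fun y => hM _) h⟩

end TransitionOperator

end NonautonomousOU

theorem mainTheorem3 :
    ∃ C : ℕ → ℝ, (∀ n, 0 < C n) ∧
      ∀ (X : Type*) [NormedAddCommGroup X] [InnerProductSpace ℝ X] [CompleteSpace X]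
        [TopologicalSpace.SeparableSpace X] [MeasurableSpace X] [BorelSpace X]
        (T : ℝ) (U : ℝ → ℝ → X →L[ℝ] X) (B : ℝ → X →L[ℝ] X) (f : ℝ → X),
        NonautonomousOU.EvolutionHyp T U B f →
        NonautonomousOU.RangeHyp T U B →
        ∀ s t : ℝ, 0 ≤ s → s < t → t ≤ T →
        ∀ φ : X → ℝ, Measurable φ → (∃ M : ℝ, ∀ x, |φ x| ≤ M) →
          (∀ k : ℕ, NonautonomousOU.IsCkb k (NonautonomousOU.transOp U B f s t φ)) ∧
          (∀ x h : X,
            Integrable (fun y => φ (y + NonautonomousOU.meanVec U f t s x) *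
                NonautonomousOU.whiteNoise (NonautonomousOU.covOp U B t s)
                  (NonautonomousOU.Lam U B t s h) y)
              (NonautonomousOU.gaussian 0 (NonautonomousOU.covOp U B t s)) ∧
            inner ℝ (gradient (NonautonomousOU.transOp U B f s t φ) x) h =
              ∫ y, φ (y + NonautonomousOU.meanVec U f t s x) *
                NonautonomousOU.whiteNoise (NonautonomousOU.covOp U B t s)
                  (NonautonomousOU.Lam U B t s h) y
                ∂(NonautonomousOU.gaussian 0 (NonautonomousOU.covOp U B t s))) ∧
          (∀ n : ℕ, 2 ≤ n → ∀ (x : X) (h : Fin n → X),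
            Integrable (fun y => φ (NonautonomousOU.meanVec U f t s x + y) *
                NonautonomousOU.In U B t s y h)
              (NonautonomousOU.gaussian 0 (NonautonomousOU.covOp U B t s)) ∧
            iteratedFDeriv ℝ n (NonautonomousOU.transOp U B f s t φ) x h =
              ∫ y, φ (NonautonomousOU.meanVec U f t s x + y) * NonautonomousOU.In U B t s y h
                ∂(NonautonomousOU.gaussian 0 (NonautonomousOU.covOp U B t s))) ∧
          (∀ n : ℕ, 1 ≤ n → ∀ x : X,
            ‖iteratedFDeriv ℝ n (NonautonomousOU.transOp U B f s t φ) x‖ ≤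
              C n * (⨆ z, |φ z|) * ‖NonautonomousOU.Lam U B t s‖ ^ n) := by
  refine ⟨fun n => NonautonomousOU.hermiteCount n * NonautonomousOU.IsIsonormal.momentConst n 1,
    fun n => ?_, ?_⟩
  · have := NonautonomousOU.hermiteCount_pos n
    unfold NonautonomousOU.IsIsonormal.momentConst
    positivity
  intro X _ _ _ _ _ _ T U B f H hR s t hs hst ht φ hφ ⟨M, hM⟩
  refine ⟨fun k => ⟨NonautonomousOU.contDiff_transOp H hR hs hst ht hφ hM, fun j _ => ⟨_, fun x =>
    NonautonomousOU.norm_iteratedFDeriv_transOp_le H hR hs hst ht hφ hM j x⟩⟩,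
    fun x h => ?_, fun n _ x h => ?_, fun n _ x => ?_⟩
  -- The gradient formula is the order-one case, where the Hermite form reduces to the white noise
  -- itself.
  · have h1 := NonautonomousOU.iteratedFDeriv_transOp H hR hs hst ht hφ hM 1 x fun _ => h
    simp only [NonautonomousOU.In, NonautonomousOU.hermiteForm_fin_one, iteratedFDeriv_one_apply]
      at h1
    rwa [inner_gradient_left]
  · simpa only [add_comm] using NonautonomousOU.iteratedFDeriv_transOp H hR hs hst ht hφ hM n x h
  -- The estimate holds for any bound of `|φ|`, so the supremum is used as `M`; boundedness of `φ`
  -- ensures that the real `⨆` is a genuine supremum.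
  · refine NonautonomousOU.norm_iteratedFDeriv_transOp_le H hR hs hst ht hφ (fun z => ?_) n x
    exact le_ciSup (f := fun z => |φ z|) ⟨M, by rintro _ ⟨z, rfl⟩; exact hM z⟩ z
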